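/- Let $c_{00}$ be the space of finitely supported real sequences indexed by $1,2,3,\dots$. For $\theta\in(0,1)$ let $\|\cdot\|_{T_\theta}$ be the unique norm on $c_{00}$ with $$\|x\|_{T_\theta}=\max\Big\{\|x\|_\infty,\ \theta\sup\Big\{\sum_{j=1}^k\|E_jx\|_{T_\theta}\ :\ k\in\mathbb N,\ k\le E_1<\dots<E_k\Big\}\Big\}\qquad(x\in c_{00}),$$ where the $E_j$ are non-empty finite sets of positive integers, $E<F$ means $\max E<\min F$, $k\le E$ means $k\le\min E$, and $E_jx$ is the restriction of $x$ to $E_j$ (extended by $0$). Let $T_\theta$ be the completion of $(c_{00},\|\cdot\|_{T_\theta})$, and let $T^*_\theta$, the original Tsirelson space, be its dual Banach space. For a Banach space $X$ with closed unit ball $B_X$, let $K(X)$ (Kottman's constant) be the supremum of all $\sigma\ge0$ for which there is a sequence $(x_n)$ in $B_X$ with $\|x_i-x_j\|\ge\sigma$ for $i\ne j$, and let $K^s(X)$ (the symmetric Kottman constant) be the supremum of all $\sigma\ge0$ for which there is a sequence $(x_n)$ in $B_X$ with $\|x_i\pm x_j\|\ge\sigma$ for $i\neq j$. A spreading model of $X$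 is a real Banach space $F$ which is the closed linear span of a sequence $(e_n)$ such that, for some bounded sequence $(x_n)$ in $X$ without norm-Cauchy subsequences, $$\lim_{n_1<\dots<n_k,\ n_1\to\infty}\Big\|\sum_{i=1}^k a_ix_{n_i}\Big\|=\Big\|\sum_{i=1}^k a_ie_i\Big\|\qquad(k\in\mathbb N,\ a_1,\dots,a_k\in\mathbb R).$$ Theorem B. For every $\varepsilon>0$ there is $\theta\in(0,1)$ such that the Banach space $X=T^*_\theta$ admits a spreading model, every spreading model of $X$ is linearly homeomorphic to $c_0$, and $$K^s(X)\le K(X)\le 1+\varepsilon.$$ (Hence a Banach space that admits a spreading model isomorphic to $c_0$ need not satisfy $K(X)=2$ or $K^s(X)=2$.) -/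

import Mathlib

open scoped ZeroAtInfty

noncomputable section

/-! ### Kottman's constants -/

/-- A sequence is `σ`-separated if the mutual distances of its terms are at least `σ`. -/
def IsSeparatedSeq {X : Type*} [NormedAddCommGroup X] (σ : ℝ) (x : ℕ → X) : Prop :=
  ∀ i j, i ≠ j → σ ≤ ‖x i - x j‖

/-- A sequence is symmetrically `σ`-separated if `‖x i ± x j‖ ≥ σ` for `i ≠ j`. -/
def IsSymmSeparatedSeq {X : Type*} [NormedAddCommGroup X] (σ : ℝ) (x : ℕ → X) : Prop :=
  ∀ i j, i ≠ j → σ ≤ ‖x i - x j‖ ∧ σ ≤ ‖x i + x j‖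

/-- Kottman's constant `K(X)`. The set contains `0` and is bounded above by `2`. -/
def kottmanConstant (X : Type*) [NormedAddCommGroup X] : ℝ :=
  sSup {σ : ℝ | 0 ≤ σ ∧ ∃ x : ℕ → X, (∀ n, ‖x n‖ ≤ 1) ∧ IsSeparatedSeq σ x}

/-- The symmetric Kottman constant `Kˢ(X)`. The set contains `0` and is bounded above by `2`. -/
def symmKottmanConstant (X : Type*) [NormedAddCommGroup X] : ℝ :=
  sSup {σ : ℝ | 0 ≤ σ ∧ ∃ x : ℕ → X, (∀ n, ‖x n‖ ≤ 1) ∧ IsSymmSeparatedSeq σ x}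

/-! ### Spreading models -/

/-- The Banach space `F`, with fundamental sequence `e`, is the spreading model generated by the
sequence `x` of `X`: the sequence `x` is bounded and has no norm-Cauchy subsequence, the norms
`‖∑ i, a i • x (n i)‖` tend to `‖∑ i, a i • e i‖` as `n 0 < n 1 < ⋯ < n (k - 1)` tend to infinity,
and the linear span of `e` is dense in `F`. -/
structure IsSpreadingModel {X : Type*} [NormedAddCommGroup X] [NormedSpace ℝ X]
    {F : Type*} [NormedAddCommGroup F] [NormedSpace ℝ F] [CompleteSpace F]
    (x : ℕ → X) (e : ℕ → F) : Prop where
  bounded : ∃ C : ℝ, ∀ n, ‖x n‖ ≤ C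
  not_cauchy : ∀ φ : ℕ → ℕ, StrictMono φ → ¬ CauchySeq (x ∘ φ)
  norm_limit : ∀ (k : ℕ) (a : Fin k → ℝ) (δ : ℝ), 0 < δ → ∃ N : ℕ, ∀ n : Fin k → ℕ,
    StrictMono n → (∀ i, N ≤ n i) →
      |‖∑ i, a i • x (n i)‖ - ‖∑ i, a i • e (i : ℕ)‖| ≤ δ
  dense_span : (Submodule.span ℝ (Set.range e)).topologicalClosure = ⊤

/-! ### Tsirelson's space -/

namespace Tsirelson

/-- The supremum norm on `c₀₀`; the coordinates are indexed by `1, 2, 3, …`. -/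
def supNorm (x : ℕ+ →₀ ℝ) : ℝ := ⨆ j, |x j|

/-- The vector `E x`, which has the coordinates of `x` on `E` and vanishes off `E`. -/
def proj (E : Finset ℕ+) (x : ℕ+ →₀ ℝ) : ℕ+ →₀ ℝ := x.filter (· ∈ E)

/-- `k ≤ E₁ < E₂ < ⋯ < Eₖ` for non-empty finite sets of positive integers. -/
structure Admissible {k : ℕ} (E : Fin k → Finset ℕ+) : Prop where
  nonempty : ∀ i, (E i).Nonempty
  le : ∀ i, ∀ n ∈ E i, k ≤ (n : ℕ)
  lt : ∀ i j, i < j → ∀ m ∈ E i, ∀ n ∈ E j, m < n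

/-- The numbers `∑ N (Eⱼ x)`, over all `k ≤ E₁ < ⋯ < Eₖ`. -/
def admissibleSums (N : (ℕ+ →₀ ℝ) → ℝ) (x : ℕ+ →₀ ℝ) : Set ℝ :=
  {s | ∃ (k : ℕ) (E : Fin k → Finset ℕ+), Admissible E ∧ s = ∑ i, N (proj (E i) x)}

/-- The right-hand side of the implicit equation for Tsirelson's norm. -/
def step (θ : ℝ) (N : (ℕ+ →₀ ℝ) → ℝ) (x : ℕ+ →₀ ℝ) : ℝ :=
  max (supNorm x) (θ * sSup (admissibleSums N x))

/-- The iterates of `step`, from the supremum norm. -/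
def iter (θ : ℝ) : ℕ → (ℕ+ →₀ ℝ) → ℝ
  | 0 => supNorm
  | n + 1 => step θ (iter θ n)

/-- Tsirelson's norm on `c₀₀`. It is the unique (semi)norm that satisfies the implicit equation
`N x = max (‖x‖_∞) (θ * sup (∑ N (Eⱼ x)))`: see `tsirelsonNorm_eq` and `tsirelsonNorm_unique`. -/
def tsirelsonNorm (θ : ℝ) (x : ℕ+ →₀ ℝ) : ℝ := ⨆ n, iter θ n x

lemma proj_add (E : Finset ℕ+) (x y : ℕ+ →₀ ℝ) : proj E (x + y) = proj E x + proj E y :=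
  Finsupp.filter_add

lemma proj_smul (E : Finset ℕ+) (c : ℝ) (x : ℕ+ →₀ ℝ) : proj E (c • x) = c • proj E x :=
  Finsupp.filter_smul

lemma sum_proj_le {w : ℕ+ → ℝ} (hw : ∀ j, 0 ≤ w j) {k : ℕ} {E : Fin k → Finset ℕ+}
    (hE : Admissible E) (x : ℕ+ →₀ ℝ) :
    ∑ i, (proj (E i) x).sum (fun j a => |a| * w j) ≤ x.sum (fun j a => |a| * w j) := by
  have h1 : ∀ i, (proj (E i) x).sum (fun j a => |a| * w j)
      = ∑ j ∈ x.support, if j ∈ E i then |x j| * w j else 0 := by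
    intro i
    rw [Finsupp.sum, proj, Finsupp.support_filter, Finset.sum_filter]
    refine Finset.sum_congr rfl fun j _ => ?_
    split_ifs with h
    · rw [Finsupp.filter_apply_pos _ _ h]
    · rfl
  simp_rw [h1]
  rw [Finset.sum_comm]
  refine Finset.sum_le_sum fun j _ => ?_
  have h0 : 0 ≤ |x j| * w j := mul_nonneg (abs_nonneg _) (hw j)
  by_cases hj : ∃ i, j ∈ E i
  · obtain ⟨i, hi⟩ := hj
    rw [Finset.sum_eq_single i, if_pos hi]
    · intro i' _ hne
      rw [if_neg]
      intro hi'
      rcases lt_or_gt_of_ne hne with h | h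
      · exact lt_irrefl _ (hE.lt _ _ h _ hi' _ hi)
      · exact lt_irrefl _ (hE.lt _ _ h _ hi _ hi')
    · simp
  · push Not at hj
    rw [Finset.sum_eq_zero fun i _ => if_neg (hj i)]
    exact h0

/-- The properties that `step` preserves. -/
structure Good (N : (ℕ+ →₀ ℝ) → ℝ) : Prop where
  nonneg : ∀ x, 0 ≤ N x
  le_sum : ∀ x, N x ≤ x.sum (fun _ a => |a| * 1)
  add_le : ∀ x y, N (x + y) ≤ N x + N y
  smul : ∀ (c : ℝ) x, N (c • x) = |c| * N x

lemma abs_le_sum (x : ℕ+ →₀ ℝ) (j : ℕ+) : |x j| ≤ x.sum (fun _ a => |a| * 1) := by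
  by_cases hj : j ∈ x.support
  · have := Finset.single_le_sum (f := fun j => |x j| * 1)
      (fun i _ => mul_nonneg (abs_nonneg _) zero_le_one) hj
    simpa [Finsupp.sum] using this
  · rw [Finsupp.notMem_support_iff.1 hj, abs_zero]
    exact Finset.sum_nonneg fun i _ => mul_nonneg (abs_nonneg _) zero_le_one

lemma bddAbove_abs (x : ℕ+ →₀ ℝ) : BddAbove (Set.range fun j => |x j|) :=
  ⟨_, by rintro _ ⟨j, rfl⟩; exact abs_le_sum x j⟩

lemma abs_le_supNorm (x : ℕ+ →₀ ℝ) (j : ℕ+) : |x j| ≤ supNorm x :=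
  le_ciSup (bddAbove_abs x) j

lemma good_supNorm : Good supNorm where
  nonneg x := (abs_nonneg (x 1)).trans (abs_le_supNorm x 1)
  le_sum x := ciSup_le fun j => abs_le_sum x j
  add_le x y := ciSup_le fun j => (abs_add_le _ _).trans
    (add_le_add (abs_le_supNorm x j) (abs_le_supNorm y j))
  smul c x := by
    simp only [supNorm, Finsupp.smul_apply, smul_eq_mul, abs_mul]
    exact (Real.mul_iSup_of_nonneg (abs_nonneg c) _).symm

lemma zero_mem_sums (N : (ℕ+ →₀ ℝ) → ℝ) (x : ℕ+ →₀ ℝ) : (0 : ℝ) ∈ admissibleSums N x :=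
  ⟨0, Fin.elim0, ⟨fun i => i.elim0, fun i => i.elim0, fun i => i.elim0⟩, by simp⟩

lemma Good.le_of_mem {N : (ℕ+ →₀ ℝ) → ℝ} (hN : Good N) {x : ℕ+ →₀ ℝ} {s : ℝ}
    (hs : s ∈ admissibleSums N x) : s ≤ x.sum (fun _ a => |a| * 1) := by
  obtain ⟨k, E, hE, rfl⟩ := hs
  exact (Finset.sum_le_sum fun i _ => hN.le_sum _).trans
    (sum_proj_le (w := fun _ => 1) (fun _ => zero_le_one) hE x)

lemma Good.bdd {N : (ℕ+ →₀ ℝ) → ℝ} (hN : Good N) (x : ℕ+ →₀ ℝ) :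
    BddAbove (admissibleSums N x) := ⟨_, fun _ hs => hN.le_of_mem hs⟩

lemma Good.zero_le_sSup {N : (ℕ+ →₀ ℝ) → ℝ} (hN : Good N) (x : ℕ+ →₀ ℝ) :
    0 ≤ sSup (admissibleSums N x) := le_csSup (hN.bdd x) (zero_mem_sums N x)

open scoped Pointwise in
lemma sums_smul {N : (ℕ+ →₀ ℝ) → ℝ} (hN : Good N) (c : ℝ) (x : ℕ+ →₀ ℝ) :
    admissibleSums N (c • x) = |c| • admissibleSums N x := by
  ext s
  simp only [admissibleSums, Set.mem_smul_set, Set.mem_ofPred_eq, proj_smul, hN.smul,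
    ← Finset.mul_sum, smul_eq_mul]
  constructor
  · rintro ⟨k, E, hE, rfl⟩
    exact ⟨_, ⟨k, E, hE, rfl⟩, rfl⟩
  · rintro ⟨_, ⟨k, E, hE, rfl⟩, rfl⟩
    exact ⟨k, E, hE, rfl⟩

open scoped Pointwise in
lemma Good.step {θ : ℝ} (h0 : 0 ≤ θ) (h1 : θ ≤ 1) {N : (ℕ+ →₀ ℝ) → ℝ} (hN : Good N) :
    Good (step θ N) where
  nonneg x := (good_supNorm.nonneg x).trans (le_max_left _ _)
  le_sum x := max_le (good_supNorm.le_sum x)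
    ((mul_le_of_le_one_left (hN.zero_le_sSup x) h1).trans
      (csSup_le ⟨0, zero_mem_sums N x⟩ fun _ hs => hN.le_of_mem hs))
  add_le x y := by
    refine max_le ((good_supNorm.add_le x y).trans
      (add_le_add (le_max_left _ _) (le_max_left _ _))) ?_
    refine le_trans ?_ (add_le_add (le_max_right _ _) (le_max_right _ _))
    rw [← mul_add]
    refine mul_le_mul_of_nonneg_left (csSup_le ⟨0, zero_mem_sums N _⟩ ?_) h0
    rintro _ ⟨k, E, hE, rfl⟩
    refine le_trans ?_ (add_le_add (le_csSup (hN.bdd x) ⟨k, E, hE, rfl⟩)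
      (le_csSup (hN.bdd y) ⟨k, E, hE, rfl⟩))
    rw [← Finset.sum_add_distrib]
    exact Finset.sum_le_sum fun i _ => by rw [proj_add]; exact hN.add_le _ _
  smul c x := by
    simp only [Tsirelson.step]
    rw [sums_smul hN, Real.sSup_smul_of_nonneg (abs_nonneg c), good_supNorm.smul, smul_eq_mul,
      mul_max_of_nonneg _ _ (abs_nonneg c)]
    congr 1
    ring

lemma good_iter {θ : ℝ} (h0 : 0 ≤ θ) (h1 : θ ≤ 1) (n : ℕ) : Good (iter θ n) := by
  induction n with
  | zero => exact good_supNorm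
  | succ n ih => exact ih.step h0 h1

lemma step_mono {θ : ℝ} (h0 : 0 ≤ θ) {N M : (ℕ+ →₀ ℝ) → ℝ} (hM : Good M)
    (h : ∀ x, N x ≤ M x) (x : ℕ+ →₀ ℝ) : step θ N x ≤ step θ M x := by
  refine max_le_max le_rfl (mul_le_mul_of_nonneg_left
    (csSup_le ⟨0, zero_mem_sums N x⟩ ?_) h0)
  rintro _ ⟨k, E, hE, rfl⟩
  exact (Finset.sum_le_sum fun i _ => h _).trans (le_csSup (hM.bdd x) ⟨k, E, hE, rfl⟩)

lemma iter_le_succ {θ : ℝ} (h0 : 0 ≤ θ) (h1 : θ ≤ 1) (n : ℕ) :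
    ∀ x, iter θ n x ≤ iter θ (n + 1) x := by
  induction n with
  | zero => exact fun x => le_max_left _ _
  | succ n ih => exact step_mono h0 (good_iter h0 h1 (n + 1)) ih

lemma iter_monotone {θ : ℝ} (h0 : 0 ≤ θ) (h1 : θ ≤ 1) (x : ℕ+ →₀ ℝ) :
    Monotone fun n => iter θ n x :=
  monotone_nat_of_le_succ fun n => iter_le_succ h0 h1 n x

lemma bddAbove_iter {θ : ℝ} (h0 : 0 ≤ θ) (h1 : θ ≤ 1) (x : ℕ+ →₀ ℝ) :
    BddAbove (Set.range fun n => iter θ n x) :=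
  ⟨_, by rintro _ ⟨n, rfl⟩; exact (good_iter h0 h1 n).le_sum x⟩

lemma iter_le_norm {θ : ℝ} (h0 : 0 ≤ θ) (h1 : θ ≤ 1) (n : ℕ) (x : ℕ+ →₀ ℝ) :
    iter θ n x ≤ tsirelsonNorm θ x := le_ciSup (bddAbove_iter h0 h1 x) n

lemma good_tsirelsonNorm {θ : ℝ} (h0 : 0 ≤ θ) (h1 : θ ≤ 1) : Good (tsirelsonNorm θ) where
  nonneg x := (good_supNorm.nonneg x).trans (iter_le_norm h0 h1 0 x)
  le_sum x := ciSup_le fun n => (good_iter h0 h1 n).le_sum x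
  add_le x y := ciSup_le fun n => ((good_iter h0 h1 n).add_le x y).trans
    (add_le_add (iter_le_norm h0 h1 n x) (iter_le_norm h0 h1 n y))
  smul c x := by
    simp only [tsirelsonNorm, (good_iter h0 h1 _).smul]
    exact (Real.mul_iSup_of_nonneg (abs_nonneg c) _).symm

open scoped Pointwise in
/-- Tsirelson's norm satisfies the implicit equation. -/
theorem tsirelsonNorm_eq {θ : ℝ} (h0 : 0 ≤ θ) (h1 : θ ≤ 1) (x : ℕ+ →₀ ℝ) :
    tsirelsonNorm θ x
      = max (supNorm x) (θ * sSup (admissibleSums (tsirelsonNorm θ) x)) := by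
  have hG := good_tsirelsonNorm h0 h1
  apply le_antisymm
  · refine ciSup_le fun n => ?_
    exact (iter_le_succ h0 h1 n x).trans (step_mono h0 hG (iter_le_norm h0 h1 n) x)
  · refine max_le (iter_le_norm h0 h1 0 x) ?_
    rw [← smul_eq_mul, ← Real.sSup_smul_of_nonneg h0]
    refine csSup_le (Set.Nonempty.smul_set ⟨0, zero_mem_sums _ x⟩) ?_
    rintro _ ⟨_, ⟨k, E, hE, rfl⟩, rfl⟩
    have ht : Filter.Tendsto (fun n => θ * ∑ i, iter θ n (proj (E i) x)) Filter.atTop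
        (nhds (θ * ∑ i, tsirelsonNorm θ (proj (E i) x))) :=
      (tendsto_finsetSum _ fun i _ => tendsto_atTop_ciSup (iter_monotone h0 h1 _)
        (bddAbove_iter h0 h1 _)).const_mul θ
    refine le_of_tendsto' ht fun n => ?_
    refine le_trans ?_ (iter_le_norm h0 h1 (n + 1) x)
    exact le_trans (mul_le_mul_of_nonneg_left
      (le_csSup ((good_iter h0 h1 n).bdd x) ⟨k, E, hE, rfl⟩) h0) (le_max_right _ _)

lemma seminorm_le_sum (N : Seminorm ℝ (ℕ+ →₀ ℝ)) (x : ℕ+ →₀ ℝ) :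
    N x ≤ x.sum (fun j a => |a| * N (Finsupp.single j 1)) := by
  conv_lhs => rw [← x.sum_single]
  refine (Finset.le_sum_of_subadditive N (map_zero N).le (map_add_le_add N) _ _).trans
    (le_of_eq ?_)
  refine Finset.sum_congr rfl fun j _ => ?_
  have h : Finsupp.single j (x j) = x j • Finsupp.single j (1 : ℝ) := by simp
  rw [h, map_smul_eq_mul, Real.norm_eq_abs]

lemma seminorm_bdd (N : Seminorm ℝ (ℕ+ →₀ ℝ)) (x : ℕ+ →₀ ℝ) :
    BddAbove (admissibleSums N x) := by
  refine ⟨x.sum (fun j a => |a| * N (Finsupp.single j 1)), ?_⟩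
  rintro _ ⟨k, E, hE, rfl⟩
  exact (Finset.sum_le_sum fun i _ => seminorm_le_sum N _).trans
    (sum_proj_le (fun j => apply_nonneg N _) hE x)

open scoped Pointwise in
lemma le_of_implicit {θ : ℝ} (h0 : 0 ≤ θ) (h1 : θ < 1) (N M : Seminorm ℝ (ℕ+ →₀ ℝ))
    (hN : ∀ x, N x = step θ N x) (hM : ∀ x, M x = step θ M x) :
    ∀ (n : ℕ) (x : ℕ+ →₀ ℝ), x.support.card ≤ n → N x ≤ M x := by
  intro n
  induction n with
  | zero =>
    intro x hx
    have : x = 0 := by simpa using hx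
    simp [this]
  | succ n ih =>
    intro x hx
    have key : ∀ s ∈ admissibleSums N x, θ * s ≤ max (M x) (θ * N x) := by
      rintro _ ⟨k, E, hE, rfl⟩
      by_cases hc : ∃ i, x.support ⊆ E i
      · obtain ⟨i, hi⟩ := hc
        refine le_trans (mul_le_mul_of_nonneg_left ?_ h0) (le_max_right _ _)
        have hx' : proj (E i) x = x := by
          rw [proj, Finsupp.filter_eq_self_iff]
          intro j hj
          exact hi (Finsupp.mem_support_iff.2 hj)
        rw [Finset.sum_eq_single i, hx']
        · intro i' _ hne
          have : proj (E i') x = 0 := by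
            rw [proj, Finsupp.filter_eq_zero_iff]
            intro j hj
            by_contra hne'
            have hji := hi (Finsupp.mem_support_iff.2 hne')
            rcases lt_or_gt_of_ne hne with h | h
            · exact lt_irrefl _ (hE.lt _ _ h _ hj _ hji)
            · exact lt_irrefl _ (hE.lt _ _ h _ hji _ hj)
          rw [this, map_zero]
        · simp
      · push Not at hc
        refine le_trans ?_ (le_max_left _ _)
        refine le_trans (mul_le_mul_of_nonneg_left (Finset.sum_le_sum fun i _ => ih _ ?_) h0) ?_
        · rw [proj, Finsupp.support_filter]
          have hss : x.support.filter (· ∈ E i) ⊂ x.support := by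
            rw [Finset.filter_ssubset]
            obtain ⟨j, hj, hj'⟩ := Finset.not_subset.1 (hc i)
            exact ⟨j, hj, hj'⟩
          have := Finset.card_lt_card hss
          omega
        · rw [hM x]
          exact le_trans (mul_le_mul_of_nonneg_left
            (le_csSup (seminorm_bdd M x) ⟨k, E, hE, rfl⟩) h0) (le_max_right _ _)
    have hle : N x ≤ max (M x) (θ * N x) := by
      conv_lhs => rw [hN x]
      refine max_le ?_ ?_
      · rw [hM x]
        exact le_max_of_le_left (le_max_left _ _)
      · rw [← smul_eq_mul, ← Real.sSup_smul_of_nonneg h0]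
        refine csSup_le (Set.Nonempty.smul_set ⟨0, zero_mem_sums _ x⟩) ?_
        rintro _ ⟨s, hs, rfl⟩
        exact key s hs
    rcases le_max_iff.1 hle with h | h
    · exact h
    · have h2 := apply_nonneg N x
      have h3 := apply_nonneg M x
      nlinarith

/-- Tsirelson's norm is the only solution of the implicit equation. -/
theorem tsirelsonNorm_unique {θ : ℝ} (h0 : 0 < θ) (h1 : θ < 1) (N : Seminorm ℝ (ℕ+ →₀ ℝ))
    (hN : ∀ x, N x = max (supNorm x) (θ * sSup (admissibleSums N x))) (x : ℕ+ →₀ ℝ) :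
    N x = tsirelsonNorm θ x := by
  have hG := good_tsirelsonNorm h0.le h1.le
  let M : Seminorm ℝ (ℕ+ →₀ ℝ) := Seminorm.of (tsirelsonNorm θ) hG.add_le
    (fun c x => by rw [hG.smul, Real.norm_eq_abs])
  have hM : ∀ x, M x = step θ M x := tsirelsonNorm_eq h0.le h1.le
  exact le_antisymm (le_of_implicit h0.le h1 N M hN hM _ x le_rfl)
    (le_of_implicit h0.le h1 M N hM hN _ x le_rfl)

/-- The space `c₀₀`, to be normed by Tsirelson's norm with parameter `θ ∈ (0, 1)`. -/
def C00 (_θ : Set.Ioo (0 : ℝ) 1) : Type := ℕ+ →₀ ℝ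

instance (θ : Set.Ioo (0 : ℝ) 1) : AddCommGroup (C00 θ) := inferInstanceAs (AddCommGroup (ℕ+ →₀ ℝ))

instance (θ : Set.Ioo (0 : ℝ) 1) : Module ℝ (C00 θ) := inferInstanceAs (Module ℝ (ℕ+ →₀ ℝ))

instance (θ : Set.Ioo (0 : ℝ) 1) : Norm (C00 θ) := ⟨tsirelsonNorm (θ : ℝ)⟩

lemma normCore (θ : Set.Ioo (0 : ℝ) 1) : NormedSpace.Core ℝ (C00 θ) where
  norm_nonneg := (good_tsirelsonNorm θ.2.1.le θ.2.2.le).nonneg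
  norm_smul := (good_tsirelsonNorm θ.2.1.le θ.2.2.le).smul
  norm_triangle := (good_tsirelsonNorm θ.2.1.le θ.2.2.le).add_le
  norm_eq_zero_iff x := by
    have hG := good_tsirelsonNorm θ.2.1.le θ.2.2.le
    constructor
    · intro h
      refine Finsupp.ext fun j => abs_eq_zero.1 (le_antisymm ?_ (abs_nonneg _))
      exact ((abs_le_supNorm x j).trans (iter_le_norm θ.2.1.le θ.2.2.le 0 x)).trans h.le
    · rintro rfl
      exact le_antisymm ((hG.le_sum 0).trans (le_of_eq Finsupp.sum_zero_index)) (hG.nonneg 0)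

instance (θ : Set.Ioo (0 : ℝ) 1) : NormedAddCommGroup (C00 θ) :=
  NormedAddCommGroup.ofCore (normCore θ)

instance (θ : Set.Ioo (0 : ℝ) 1) : NormedSpace ℝ (C00 θ) :=
  NormedSpace.ofCore (normCore θ)

/-- Tsirelson's space `T_θ`: the completion of `c₀₀` under Tsirelson's norm. -/
abbrev T (θ : Set.Ioo (0 : ℝ) 1) : Type := UniformSpace.Completion (C00 θ)

/-- The original Tsirelson space `T*_θ`: the dual Banach space of `T_θ`. -/
abbrev TDual (θ : Set.Ioo (0 : ℝ) 1) : Type := StrongDual ℝ (T θ)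

end Tsirelson

end

noncomputable section

/-! ### Tsirelson's norm under restriction to sets of coordinates -/

namespace Tsirelson

/-! The implicit equation gives `∑ ‖Eᵢ u‖ ≤ θ⁻¹ ‖u‖` for admissible `k ≤ E₁ < ⋯ < Eₖ`
(`admissible_sum_le`). By duality, `k` functionals of norm at most `C` that live on such sets have a
sum of norm at most `C θ⁻¹`, however large `k` is. So the dual looks like `c₀` asymptotically, with
constant `θ⁻¹`, and `θ = (1 + ε)⁻¹` makes this constant `1 + ε`.

To reach this situation from a bounded sequence `x n` of functionals, take a weak* cluster point
`y`. The differences `x n - y` are weak* null along an ultrafilter, hence small on any fixed initial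
segment for suitable `n`. They are also small far out, because the basis is shrinking
(`exists_tail_le`). A gliding hump (`exists_successive_sets`, `exists_admissible`) then almost
places them on admissible sets on which `y` is negligible too. With two terms of a separated
sequence in the unit ball, `y` cancels in the difference, and `σ ≤ θ⁻¹` follows
(`le_inv_of_isSeparatedSeq`).

With `k` terms, `∑ aᵢ x (nᵢ) = (∑ aᵢ) y + ∑ aᵢ (x (nᵢ) - y)`, and the norm in a spreading model is
equivalent to `max ‖a‖_∞ (‖y‖ |∑ aᵢ|)` (`exists_equivalent_norm`). For `y = 0` this is the unit
vector basis of `c₀`. For `y ≠ 0` it is the sequence `e₀ + eᵢ₊₁`, which still spans a dense subspace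
of `c₀`. A spreading model exists because the norm of `∑ aᵢ e*_{nᵢ}` does not depend on the `nᵢ`
once `k ≤ n₁ < ⋯ < nₖ` (`norm_sum_basis_eq`). -/

lemma supNorm_le {x : ℕ+ →₀ ℝ} {c : ℝ} (h : ∀ j, |x j| ≤ c) : supNorm x ≤ c := ciSup_le h

lemma proj_apply (E : Finset ℕ+) (x : ℕ+ →₀ ℝ) (j : ℕ+) :
    proj E x j = if j ∈ E then x j else 0 := by
  rw [proj, Finsupp.filter_apply]

lemma proj_eq_zero {E : Finset ℕ+} {x : ℕ+ →₀ ℝ} (h : ∀ j ∈ E, x j = 0) : proj E x = 0 := by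
  rw [proj, Finsupp.filter_eq_zero_iff]
  exact h

lemma mem_of_mem_support_proj {E : Finset ℕ+} {x : ℕ+ →₀ ℝ} {j : ℕ+}
    (h : j ∈ (proj E x).support) : j ∈ E := by
  rw [proj, Finsupp.support_filter] at h
  exact (Finset.mem_filter.1 h).2

lemma proj_filter (E : Finset ℕ+) (p : ℕ+ → Prop) [DecidablePred p] (x : ℕ+ →₀ ℝ) :
    proj E (x.filter p) = (proj E x).filter p := by
  ext j
  simp only [proj, Finsupp.filter_apply]
  split_ifs <;> rfl

/-- Restriction commutes with every `proj E`, so monotonicity passes from one iterate to the next,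
and then to the supremum in `norm_filter_le`. -/
lemma iter_filter_le {θ : ℝ} (h0 : 0 ≤ θ) (h1 : θ ≤ 1) (p : ℕ+ → Prop) [DecidablePred p] (n : ℕ) :
    ∀ x, iter θ n (x.filter p) ≤ iter θ n x := by
  have hs : ∀ x : ℕ+ →₀ ℝ, supNorm (x.filter p) ≤ supNorm x := by
    refine fun x => supNorm_le fun j => ?_
    rw [Finsupp.filter_apply]
    split_ifs
    · exact abs_le_supNorm x j
    · rw [abs_zero]; exact good_supNorm.nonneg x
  induction n with
  | zero => exact hs
  | succ n ih =>
    intro x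
    refine max_le_max (hs x) (mul_le_mul_of_nonneg_left
      (csSup_le ⟨0, zero_mem_sums _ _⟩ ?_) h0)
    rintro _ ⟨k, E, hE, rfl⟩
    refine le_trans (Finset.sum_le_sum fun i _ => ?_)
      (le_csSup ((good_iter h0 h1 n).bdd x) ⟨k, E, hE, rfl⟩)
    rw [proj_filter]
    exact ih _

section Norm

variable {θ : ℝ} (h0 : 0 ≤ θ) (h1 : θ ≤ 1)
include h0 h1

lemma norm_filter_le (p : ℕ+ → Prop) [DecidablePred p] (x : ℕ+ →₀ ℝ) :
    tsirelsonNorm θ (x.filter p) ≤ tsirelsonNorm θ x :=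
  ciSup_le fun n => (iter_filter_le h0 h1 p n x).trans (iter_le_norm h0 h1 n x)

lemma norm_proj_le (E : Finset ℕ+) (x : ℕ+ →₀ ℝ) :
    tsirelsonNorm θ (proj E x) ≤ tsirelsonNorm θ x := norm_filter_le h0 h1 _ x

lemma abs_le_norm (x : ℕ+ →₀ ℝ) (j : ℕ+) : |x j| ≤ tsirelsonNorm θ x :=
  (abs_le_supNorm x j).trans (iter_le_norm h0 h1 0 x)

lemma norm_zero' : tsirelsonNorm θ 0 = 0 := by
  simpa using (good_tsirelsonNorm h0 h1).smul 0 0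

lemma norm_pos {x : ℕ+ →₀ ℝ} (hx : x ≠ 0) : 0 < tsirelsonNorm θ x := by
  obtain ⟨j, hj⟩ := Finsupp.ne_iff.1 hx
  exact (abs_pos.2 hj).trans_le (abs_le_norm h0 h1 x j)

lemma admissible_sum_le {k : ℕ} {E : Fin k → Finset ℕ+} (hE : Admissible E) (x : ℕ+ →₀ ℝ) :
    θ * ∑ i, tsirelsonNorm θ (proj (E i) x) ≤ tsirelsonNorm θ x := by
  conv_rhs => rw [tsirelsonNorm_eq h0 h1]
  exact le_max_of_le_right (mul_le_mul_of_nonneg_left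
    (le_csSup ((good_tsirelsonNorm h0 h1).bdd x) ⟨k, E, hE, rfl⟩) h0)

open scoped Pointwise in
lemma norm_le {x : ℕ+ →₀ ℝ} {c : ℝ} (hs : ∀ j, |x j| ≤ c)
    (hE : ∀ (k : ℕ) (E : Fin k → Finset ℕ+), Admissible E →
      θ * ∑ i, tsirelsonNorm θ (proj (E i) x) ≤ c) : tsirelsonNorm θ x ≤ c := by
  rw [tsirelsonNorm_eq h0 h1]
  refine max_le (supNorm_le hs) ?_
  rw [← smul_eq_mul, ← Real.sSup_smul_of_nonneg h0]
  refine csSup_le (Set.Nonempty.smul_set ⟨0, zero_mem_sums _ x⟩) ?_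
  rintro _ ⟨_, ⟨k, E, hA, rfl⟩, rfl⟩
  exact hE k E hA

/-! ### A vector plus an average of later blocks -/

/-- If `w` meets at most one of the sets `E i`, then the corresponding sum is at most the norm. -/
lemma sum_proj_le_norm {k : ℕ} {E : Fin k → Finset ℕ+} {w : ℕ+ →₀ ℝ}
    (h : ∀ i i', i < i' → proj (E i) w = 0 ∨ proj (E i') w = 0) :
    ∑ i, tsirelsonNorm θ (proj (E i) w) ≤ tsirelsonNorm θ w := by
  by_cases hw : ∃ i, proj (E i) w ≠ 0
  · obtain ⟨i, hi⟩ := hw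
    rw [Finset.sum_eq_single i]
    · exact norm_proj_le h0 h1 _ _
    · intro i' _ hne
      have : proj (E i') w = 0 := by
        rcases lt_or_gt_of_ne hne with hlt | hlt
        · exact (h _ _ hlt).resolve_right hi
        · exact (h _ _ hlt).resolve_left hi
      rw [this, norm_zero' h0 h1]
    · simp
  · push Not at hw
    rw [Finset.sum_eq_zero fun i _ => by rw [hw i, norm_zero' h0 h1]]
    exact (good_tsirelsonNorm h0 h1).nonneg w

lemma norm_sum_le {ι : Type*} (s : Finset ι) (f : ι → ℕ+ →₀ ℝ) :
    tsirelsonNorm θ (∑ i ∈ s, f i) ≤ ∑ i ∈ s, tsirelsonNorm θ (f i) :=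
  Finset.le_sum_of_subadditive _ (norm_zero' h0 h1).le (good_tsirelsonNorm h0 h1).add_le _ _

omit h0 h1 in
lemma proj_sum {ι : Type*} (E : Finset ℕ+) (s : Finset ι) (f : ι → ℕ+ →₀ ℝ) :
    proj E (∑ i ∈ s, f i) = ∑ i ∈ s, proj E (f i) :=
  map_sum (Finsupp.filterAddHom (· ∈ E)) f s

omit h0 h1 in
/-- At most `k` of the successive vectors `v i` meet two of the sets `E₁ < ⋯ < Eₖ`. -/
lemma card_meeting_two_le {k r : ℕ} {E : Fin k → Finset ℕ+} (hE : Admissible E)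
    {v : ℕ → ℕ+ →₀ ℝ} (hv : ∀ i i', i < i' → ∀ a ∈ (v i).support, ∀ b ∈ (v i').support, a < b) :
    ((Finset.range r).filter fun i => ∃ j j', j < j' ∧ proj (E j) (v i) ≠ 0 ∧
      proj (E j') (v i) ≠ 0).card ≤ k := by
  classical
  set B := (Finset.range r).filter fun i => ∃ j j', j < j' ∧ proj (E j) (v i) ≠ 0 ∧
      proj (E j') (v i) ≠ 0
  have hB : ∀ i : B, ∃ j j', j < j' ∧ proj (E j) (v i) ≠ 0 ∧ proj (E j') (v i) ≠ 0 :=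
    fun i => (Finset.mem_filter.1 i.2).2
  choose j j' hlt hj hj' using hB
  have meet : ∀ {j : Fin k} {i : ℕ}, proj (E j) (v i) ≠ 0 → ∃ a ∈ E j, a ∈ (v i).support := by
    intro j i h
    by_contra! hcon
    exact h (proj_eq_zero fun a ha => Finsupp.notMem_support_iff.1 (hcon a ha))
  -- If `v i` and a later `v i'` shared their second set, the first set of `v i'` would precede a
  -- point of `v i`, against the order of the supports.
  have key : ∀ i i' : B, (i : ℕ) < i' → j' i ≠ j' i' := by
    intro i i' hii h
    obtain ⟨a, ha, ha'⟩ := meet (hj' i)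
    obtain ⟨b, hb, hb'⟩ := meet (hj i')
    have h2 := hE.lt _ _ (hlt i') b hb a (h ▸ ha)
    exact lt_asymm h2 (hv _ _ hii _ ha' _ hb')
  have hinj : Function.Injective j' := by
    intro i i' h
    rcases lt_trichotomy (i : ℕ) i' with hl | hl | hl
    · exact absurd h (key _ _ hl)
    · exact Subtype.ext hl
    · exact absurd h.symm (key _ _ hl)
  simpa using Fintype.card_le_of_injective j' hinj

/-- An admissible family that meets `u` has at most `M` sets, too few to split most of the later
blocks. Thus the average contributes about `θ` instead of `1`. This gain over the trivial bound `2`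
makes the basis shrinking. -/
lemma norm_add_average_le {M r : ℕ} (hr : 0 < r) {u : ℕ+ →₀ ℝ} {v : ℕ → ℕ+ →₀ ℝ}
    (hu : tsirelsonNorm θ u ≤ 1) (hv : ∀ i, tsirelsonNorm θ (v i) ≤ 1)
    (huM : ∀ j ∈ u.support, (j : ℕ) ≤ M) (hvM : ∀ i, ∀ j ∈ (v i).support, M < (j : ℕ))
    (hsucc : ∀ i i', i < i' → ∀ a ∈ (v i).support, ∀ b ∈ (v i').support, a < b) :
    tsirelsonNorm θ (u + (r : ℝ)⁻¹ • ∑ i ∈ Finset.range r, v i) ≤ 1 + θ + M / r := by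
  have hG := good_tsirelsonNorm h0 h1
  have hr' : (0 : ℝ) < r := Nat.cast_pos.2 hr
  have hMr : (0 : ℝ) ≤ M / r := by positivity
  set w := (r : ℝ)⁻¹ • ∑ i ∈ Finset.range r, v i with hw
  have hwN : tsirelsonNorm θ w ≤ 1 := by
    rw [hw, hG.smul, abs_of_nonneg (by positivity)]
    have : tsirelsonNorm θ (∑ i ∈ Finset.range r, v i) ≤ r :=
      (norm_sum_le h0 h1 _ _).trans ((Finset.sum_le_sum fun i _ => hv i).trans (by simp))
    rw [inv_mul_le_iff₀ hr']
    simpa using this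
  have hwM : ∀ j : ℕ+, (j : ℕ) ≤ M → w j = 0 := by
    intro j hj
    rw [hw, Finsupp.smul_apply, Finsupp.finsetSum_apply, Finset.sum_eq_zero, smul_zero]
    intro i _
    by_contra hne
    exact absurd (hvM i j (Finsupp.mem_support_iff.2 hne)) (not_lt.2 hj)
  have huM' : ∀ j : ℕ+, M < (j : ℕ) → u j = 0 := by
    intro j hj
    by_contra hne
    exact absurd (huM j (Finsupp.mem_support_iff.2 hne)) (not_le.2 hj)
  refine norm_le h0 h1 ?_ ?_
  · intro j
    rw [Finsupp.add_apply]
    rcases le_or_gt (j : ℕ) M with hj | hj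
    · rw [hwM j hj, add_zero]
      linarith [abs_le_norm h0 h1 u j]
    · rw [huM' j hj, zero_add]
      linarith [abs_le_norm h0 h1 w j]
  · intro k E hE
    -- More than `M` sets all start beyond `u` and see only the average. With `k ≤ M`, a block that
    -- meets at most one set contributes at most `θ`, and at most `k` blocks meet two.
    rcases lt_or_ge M k with hk | hk
    · have : ∀ i, proj (E i) (u + w) = proj (E i) w := by
        intro i
        rw [proj_add, proj_eq_zero, zero_add]
        exact fun j hj => huM' j (hk.trans_le (hE.le i j hj))
      simp_rw [this]
      linarith [admissible_sum_le h0 h1 hE w]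
    · have hvi : ∀ i, θ * ∑ j, tsirelsonNorm θ (proj (E j) (v i)) ≤
          θ + if ∃ j j', j < j' ∧ proj (E j) (v i) ≠ 0 ∧ proj (E j') (v i) ≠ 0 then 1 else 0 := by
        intro i
        split_ifs with h
        · linarith [admissible_sum_le h0 h1 hE (v i), hv i]
        · push Not at h
          rw [add_zero]
          refine mul_le_of_le_one_right h0 ((sum_proj_le_norm h0 h1 ?_).trans (hv i))
          intro j j' hjj
          by_cases hz : proj (E j) (v i) = 0
          · exact Or.inl hz
          · exact Or.inr (h j j' hjj hz)
      have hsum : ∑ i ∈ Finset.range r, θ * ∑ j, tsirelsonNorm θ (proj (E j) (v i)) ≤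
          r * θ + M := by
        refine (Finset.sum_le_sum fun i _ => hvi i).trans ?_
        rw [Finset.sum_add_distrib, Finset.sum_boole]
        have := (card_meeting_two_le (r := r) hE hsucc).trans hk
        have h2 : ((((Finset.range r).filter fun i => ∃ j j', j < j' ∧ proj (E j) (v i) ≠ 0 ∧
          proj (E j') (v i) ≠ 0).card : ℕ) : ℝ) ≤ M := by exact_mod_cast this
        simp only [Finset.sum_const, Finset.card_range, nsmul_eq_mul]
        linarith
      have hwE : ∀ j, tsirelsonNorm θ (proj (E j) w) ≤
          (r : ℝ)⁻¹ * ∑ i ∈ Finset.range r, tsirelsonNorm θ (proj (E j) (v i)) := by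
        intro j
        rw [hw, proj_smul, hG.smul, abs_of_nonneg (by positivity), proj_sum]
        gcongr
        exact norm_sum_le h0 h1 _ _
      calc θ * ∑ j, tsirelsonNorm θ (proj (E j) (u + w))
          ≤ θ * ∑ j, (tsirelsonNorm θ (proj (E j) u) +
            (r : ℝ)⁻¹ * ∑ i ∈ Finset.range r, tsirelsonNorm θ (proj (E j) (v i))) := by
            gcongr with j
            rw [proj_add]
            exact (hG.add_le _ _).trans (add_le_add le_rfl (hwE j))
        _ = θ * ∑ j, tsirelsonNorm θ (proj (E j) u) +
            (r : ℝ)⁻¹ * ∑ i ∈ Finset.range r, θ * ∑ j, tsirelsonNorm θ (proj (E j) (v i)) := by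
            rw [Finset.sum_add_distrib, ← Finset.mul_sum, ← Finset.mul_sum,
              Finset.sum_comm (s := Finset.range r)]
            ring
        _ ≤ 1 + (r : ℝ)⁻¹ * (r * θ + M) := by
            gcongr
            exact (admissible_sum_le h0 h1 hE u).trans hu
        _ = 1 + θ + M / r := by field_simp; ring

end Norm

/-! ### The basis is shrinking -/

/-- Block sequences of vectors that are given beyond each index. -/
lemma exists_successive {P : (ℕ+ →₀ ℝ) → Prop} (m : ℕ)
    (h : ∀ m' : ℕ, m ≤ m' → ∃ u, P u ∧ ∀ j ∈ u.support, m' < (j : ℕ)) :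
    ∃ (v : ℕ → ℕ+ →₀ ℝ) (b : ℕ → ℕ), Monotone b ∧ b 0 = m ∧ (∀ i, P (v i)) ∧
      ∀ i, ∀ j ∈ (v i).support, b i < (j : ℕ) ∧ (j : ℕ) ≤ b (i + 1) := by
  choose! U hU hU' using h
  let b : ℕ → ℕ := fun n => n.rec m fun _ c => max c ((U c).support.sup fun j => (j : ℕ))
  have hb : Monotone b := monotone_nat_of_le_succ fun n => le_max_left _ _
  have hm : ∀ i, m ≤ b i := fun i => hb (Nat.zero_le i)
  refine ⟨fun i => U (b i), b, hb, rfl, fun i => hU _ (hm i), fun i j hj => ⟨hU' _ (hm i) j hj, ?_⟩⟩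
  exact le_max_of_le_right (Finset.le_sup (f := fun j : ℕ+ => (j : ℕ)) hj)

/-- The unit vector basis of Tsirelson's space is shrinking. -/
theorem exists_tail_le {θ : ℝ} (h0 : 0 ≤ θ) (h1 : θ < 1) (g : (ℕ+ →₀ ℝ) →ₗ[ℝ] ℝ) {C : ℝ}
    (hg : ∀ u, |g u| ≤ C * tsirelsonNorm θ u) {η : ℝ} (hη : 0 < η) :
    ∃ m : ℕ, ∀ u : ℕ+ →₀ ℝ, (∀ j ∈ u.support, m < (j : ℕ)) → |g u| ≤ η * tsirelsonNorm θ u := by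
  have hG := good_tsirelsonNorm h0 h1.le
  -- The infimum `l` of `S` is the limit of the norms of `g` on the tails. It has to be shown that
  -- `l = 0`.
  let S : Set ℝ := {c | 0 ≤ c ∧ ∃ m : ℕ, ∀ u : ℕ+ →₀ ℝ, (∀ j ∈ u.support, m < (j : ℕ)) →
    |g u| ≤ c * tsirelsonNorm θ u}
  have hS0 : BddBelow S := ⟨0, fun c hc => hc.1⟩
  have hSne : S.Nonempty := ⟨|C|, abs_nonneg _, 0, fun u _ => (hg u).trans
    (mul_le_mul_of_nonneg_right (le_abs_self C) (hG.nonneg u))⟩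
  have hl0 : 0 ≤ sInf S := le_csInf hSne fun c hc => hc.1
  rcases hl0.eq_or_lt with hl | hl
  · obtain ⟨c, ⟨hc0, m, hm⟩, hc⟩ := exists_lt_of_csInf_lt hSne (hl ▸ hη : sInf S < η)
    exact ⟨m, fun u hu => (hm u hu).trans (mul_le_mul_of_nonneg_right hc.le (hG.nonneg u))⟩
  exfalso
  set l := sInf S with hldef
  -- Chosen so that `1 + θ + δ = 2 - δ`: one `δ` absorbs `b 1 / r`, the other is the remaining gain.
  set δ := (1 - θ) / 2 with hδ
  have hδ0 : 0 < δ := by rw [hδ]; linarith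
  have hδ1 : δ < 1 := by rw [hδ]; linarith
  obtain ⟨c, ⟨hc0, m, hm⟩, hc⟩ := exists_lt_of_csInf_lt hSne
    (show sInf S < l * (1 + δ / 8) by nlinarith)
  -- Since `l` is the infimum, every tail contains vectors of the unit ball that almost attain `l`.
  have hex : ∀ m' : ℕ, m ≤ m' → ∃ u, (tsirelsonNorm θ u ≤ 1 ∧ l * (1 - δ / 8) ≤ g u) ∧
      ∀ j ∈ u.support, m' < (j : ℕ) := by
    intro m' _
    have hnot : l * (1 - δ / 8) ∉ S := fun hmem =>
      absurd (csInf_le hS0 hmem) (by rw [← hldef]; nlinarith)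
    have : ∃ u : ℕ+ →₀ ℝ, (∀ j ∈ u.support, m' < (j : ℕ)) ∧
        l * (1 - δ / 8) * tsirelsonNorm θ u < |g u| := by
      by_contra! hcon
      exact hnot ⟨by nlinarith, m', hcon⟩
    obtain ⟨u, hu, hlt⟩ := this
    have hu0 : u ≠ 0 := by
      rintro rfl
      simp [norm_zero' h0 h1.le] at hlt
    have hpos := norm_pos h0 h1.le hu0
    obtain ⟨s, hs, hsg⟩ : ∃ s : ℝ, |s| = 1 ∧ s * g u = |g u| := by
      rcases le_total 0 (g u) with h | h
      · exact ⟨1, by simp, by rw [abs_of_nonneg h, one_mul]⟩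
      · exact ⟨-1, by simp, by rw [abs_of_nonpos h]; ring⟩
    refine ⟨(s * (tsirelsonNorm θ u)⁻¹) • u, ⟨?_, ?_⟩, ?_⟩
    · rw [hG.smul, abs_mul, hs, one_mul, abs_of_pos (inv_pos.2 hpos), inv_mul_cancel₀ hpos.ne']
    · rw [map_smul, smul_eq_mul, mul_right_comm, hsg, ← div_eq_mul_inv, le_div_iff₀ hpos]
      exact hlt.le
    · exact fun j hj => hu j (Finsupp.support_smul hj)
  obtain ⟨v, b, hb, hbm, hv, hvb⟩ := exists_successive m hex
  have hvs : ∀ i, ∀ j ∈ (v i).support, m < (j : ℕ) := fun i j hj =>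
    (hbm ▸ hb (Nat.zero_le i)).trans_lt (hvb i j hj).1
  obtain ⟨r, hr⟩ := exists_nat_gt (b 1 / δ)
  have hr0 : (0 : ℝ) < r := lt_of_le_of_lt (by positivity) hr
  have hrb : (b 1 : ℝ) / r ≤ δ := by
    rw [div_le_iff₀ hr0]
    rw [div_lt_iff₀ hδ0] at hr
    linarith
  have hN := norm_add_average_le h0 h1.le (M := b 1) (r := r) (by exact_mod_cast hr0)
    (u := v 0) (v := fun i => v (i + 1)) (hv 0).1 (fun i => (hv _).1) (fun j hj => (hvb 0 j hj).2)
    (fun i j hj => (hb (by omega)).trans_lt (hvb (i + 1) j hj).1)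
    (fun i i' hii a ha c hc => by
      have h1 := (hvb _ _ ha).2
      have h2 := (hvb _ _ hc).1
      have h3 : b (i + 1 + 1) ≤ b (i' + 1) := hb (by omega)
      exact_mod_cast (show (a : ℕ) < c by omega))
  set w := v 0 + (r : ℝ)⁻¹ • ∑ i ∈ Finset.range r, v (i + 1) with hw
  have hws : ∀ j ∈ w.support, m < (j : ℕ) := by
    intro j hj
    by_contra hcon
    have hz : ∀ i, v i j = 0 := fun i => by
      by_contra hne
      exact hcon (hvs i j (Finsupp.mem_support_iff.2 hne))
    refine Finsupp.mem_support_iff.1 hj ?_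
    rw [hw, Finsupp.add_apply, Finsupp.smul_apply, Finsupp.finsetSum_apply]
    simp [hz]
  have hgw : 2 * (l * (1 - δ / 8)) ≤ g w := by
    rw [hw, map_add, map_smul, map_sum, smul_eq_mul]
    have : (r : ℝ) * (l * (1 - δ / 8)) ≤ ∑ i ∈ Finset.range r, g (v (i + 1)) := by
      refine le_trans (le_of_eq ?_) (Finset.sum_le_sum fun i _ => (hv (i + 1)).2)
      simp
    have h2 : l * (1 - δ / 8) ≤ (r : ℝ)⁻¹ * ∑ i ∈ Finset.range r, g (v (i + 1)) := by
      rw [le_inv_mul_iff₀ hr0]; exact this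
    linarith [(hv 0).2]
  have h3 : g w ≤ c * (2 - δ) := by
    refine (le_abs_self _).trans ((hm w hws).trans (mul_le_mul_of_nonneg_left ?_ hc0))
    rw [hδ] at hrb ⊢
    linarith
  have h4 : c * (2 - δ) ≤ l * (1 + δ / 8) * (2 - δ) :=
    mul_le_mul_of_nonneg_right hc.le (by linarith)
  -- The contradiction is `2 (1 - δ / 8) ≤ (1 + δ / 8) (2 - δ)`, which fails for `δ > 0`.
  nlinarith [mul_pos hl hδ0, mul_pos (mul_pos hl hδ0) hδ0]

end Tsirelson

namespace Tsirelson

open Filter Topology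

/-! ### Functionals on the completion, tested on `c₀₀` -/

section Dual

variable {θ : Set.Ioo (0 : ℝ) 1}

/-- The restriction to `c₀₀` of a functional on Tsirelson's space. -/
def ev : TDual θ →ₗ[ℝ] (ℕ+ →₀ ℝ) →ₗ[ℝ] ℝ where
  toFun f := f.toLinearMap ∘ₗ
    (UniformSpace.Completion.toComplₗᵢ (𝕜 := ℝ) (E := C00 θ)).toLinearMap
  map_add' _ _ := rfl
  map_smul' _ _ := rfl

lemma good_norm (θ : Set.Ioo (0 : ℝ) 1) : Good (tsirelsonNorm θ) :=
  good_tsirelsonNorm θ.2.1.le θ.2.2.le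

lemma abs_ev_le (f : TDual θ) (u : ℕ+ →₀ ℝ) : |ev f u| ≤ ‖f‖ * tsirelsonNorm θ u := by
  have h := f.le_opNorm ((show C00 θ from u : C00 θ) : T θ)
  rw [UniformSpace.Completion.norm_coe] at h
  exact h

lemma norm_le_of_abs_ev_le {f : TDual θ} {C : ℝ} (hC : 0 ≤ C)
    (h : ∀ u, |ev f u| ≤ C * tsirelsonNorm θ u) : ‖f‖ ≤ C := by
  refine f.opNorm_le_bound hC fun v => ?_
  induction v using UniformSpace.Completion.induction_on with
  | hp => exact isClosed_le (by fun_prop) (by fun_prop)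
  | ih u =>
    rw [UniformSpace.Completion.norm_coe]
    exact h u

lemma exists_ev_eq (g : (ℕ+ →₀ ℝ) →ₗ[ℝ] ℝ) {C : ℝ}
    (h : ∀ u, |g u| ≤ C * tsirelsonNorm θ u) : ∃ f : TDual θ, ev f = g := by
  let e : C00 θ →ₗ[ℝ] T θ := (UniformSpace.Completion.toComplₗᵢ (𝕜 := ℝ)).toLinearMap
  let g' : C00 θ →ₗ[ℝ] ℝ := g
  refine ⟨g'.extendOfNorm e, LinearMap.ext fun u => ?_⟩
  refine LinearMap.extendOfNorm_eq (f := g') (e := e)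
    UniformSpace.Completion.denseRange_coe ⟨C, fun v => ?_⟩ u
  have : ‖e v‖ = tsirelsonNorm θ v := UniformSpace.Completion.norm_coe v
  rw [this]
  exact h v

/-- By density, finitely supported vectors almost norm `f`. The norm of `u` is kept as a positive
factor, to be cancelled at the end of each estimate. -/
lemma exists_lt_abs_ev {f : TDual θ} {c : ℝ} (hc : 0 ≤ c) (h : c < ‖f‖) :
    ∃ u, 0 < tsirelsonNorm θ u ∧ c * tsirelsonNorm θ u < |ev f u| := by
  by_contra! hcon
  refine absurd (norm_le_of_abs_ev_le hc fun u => ?_) (not_le.2 h)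
  by_cases hu : u = 0
  · simp [hu, norm_zero' θ.2.1.le θ.2.2.le]
  · exact hcon u (norm_pos θ.2.1.le θ.2.2.le hu)

end Dual

/-! ### Weak* limits and the gliding hump -/

/-- Bounded sequences of functionals have pointwise limits along ultrafilters. -/
lemma exists_pointwise_limit {V : Type*} [NormedAddCommGroup V] [NormedSpace ℝ V]
    (x : ℕ → StrongDual ℝ V) {C : ℝ} (hx : ∀ n, ‖x n‖ ≤ C) (U : Ultrafilter ℕ) :
    ∃ y : StrongDual ℝ V, ∀ v, Tendsto (fun n => x n v) U (𝓝 (y v)) := by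
  have hK := WeakDual.isCompact_closedBall (𝕜 := ℝ) (E := V) 0 C
  obtain ⟨y, -, hy⟩ := hK.ultrafilter_le_nhds
    (U.map fun n => StrongDual.toWeakDual (x n)) (by
      rw [Filter.le_principal_iff, Ultrafilter.mem_coe, Ultrafilter.mem_map]
      refine Filter.univ_mem' fun n => ?_
      simpa using hx n)
  refine ⟨WeakDual.toStrongDual y, fun v => ?_⟩
  exact ((WeakDual.eval_continuous v).tendsto y).comp
    (show Tendsto (fun n => StrongDual.toWeakDual (x n)) U (𝓝 y) from hy)

/-- Only finitely many coordinates are involved, so convergence to `0` at the unit vectors makes an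
initial segment uniformly small. -/
lemma abs_apply_filter_le {θ : ℝ} (h0 : 0 ≤ θ) (h1 : θ ≤ 1) (g : (ℕ+ →₀ ℝ) →ₗ[ℝ] ℝ) (p : ℕ+)
    (u : ℕ+ →₀ ℝ) : |g (u.filter (· ≤ p))| ≤
      (∑ j ∈ Finset.Iic p, |g (Finsupp.single j 1)|) * tsirelsonNorm θ u := by
  have h : u.filter (· ≤ p) = ∑ j ∈ Finset.Iic p, u j • Finsupp.single j (1 : ℝ) := by
    ext i
    simp [Finsupp.filter_apply, Finsupp.finsetSum_apply, Finsupp.single_apply]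
  rw [h, map_sum, Finset.sum_mul]
  refine (Finset.abs_sum_le_sum_abs _ _).trans (Finset.sum_le_sum fun j _ => ?_)
  rw [map_smul, smul_eq_mul, abs_mul, mul_comm]
  exact mul_le_mul_of_nonneg_left (abs_le_norm h0 h1 u j) (abs_nonneg _)

/-- Gliding hump: a weak* null sequence has terms that are almost supported on successive sets. -/
lemma exists_successive_sets {θ : ℝ} (h0 : 0 ≤ θ) (h1 : θ < 1) {y : ℕ → (ℕ+ →₀ ℝ) →ₗ[ℝ] ℝ}
    {C : ℕ → ℝ} (hC : ∀ n u, |y n u| ≤ C n * tsirelsonNorm θ u) {U : Filter ℕ} [NeBot U]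
    (hU : U ≤ atTop) (hy : ∀ u, Tendsto (fun n => y n u) U (𝓝 0)) {η : ℝ} (hη : 0 < η) (k : ℕ) :
    ∀ L m : ℕ, ∃ (n : Fin k → ℕ) (E : Fin k → Finset ℕ+), StrictMono n ∧ (∀ i, L ≤ n i) ∧
      (∀ i, (E i).Nonempty) ∧ (∀ i, ∀ j ∈ E i, m < (j : ℕ)) ∧
      (∀ i i', i < i' → ∀ a ∈ E i, ∀ b ∈ E i', a < b) ∧
      ∀ i u, |y (n i) (u - proj (E i) u)| ≤ η * tsirelsonNorm θ u := by
  have hG := good_tsirelsonNorm h0 h1.le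
  induction k with
  | zero =>
    exact fun L m => ⟨Fin.elim0, Fin.elim0, fun i => i.elim0, fun i => i.elim0, fun i => i.elim0,
      fun i => i.elim0, fun i => i.elim0, fun i => i.elim0⟩
  | succ k ih =>
    intro L m
    set p : ℕ+ := m.succPNat with hp
    have hsum : Tendsto (fun n => ∑ j ∈ Finset.Iic p, |y n (Finsupp.single j 1)|) U (𝓝 0) := by
      have := tendsto_finsetSum (Finset.Iic p) fun j _ => (hy (Finsupp.single j 1)).abs
      simpa using this
    -- Half of `η` pays for the coordinates up to `p`, where `y n₀` is small by weak* convergence.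
    -- The other half pays for those beyond `q`, by the shrinking property.
    obtain ⟨n₀, hn₀, hL⟩ := ((hsum.eventually_lt_const (half_pos hη)).and
      (hU (eventually_ge_atTop L))).exists
    obtain ⟨t, ht⟩ := exists_tail_le h0 h1 (y n₀) (hC n₀) (half_pos hη)
    set q : ℕ+ := p + t.succPNat with hq
    have hpq : p < q := PNat.lt_add_right _ _
    have htq : t < (q : ℕ) := by simp [hq]; omega
    -- The remaining terms are sought after `n₀` and beyond `q`, which is why the induction is
    -- uniform in `L` and `m`.
    obtain ⟨n, E, hn, hLn, hne, hmE, hlt, happ⟩ := ih (n₀ + 1) q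
    refine ⟨Fin.cons n₀ n, Fin.cons (Finset.Ioc p q) E, ?_, ?_, ?_, ?_, ?_, ?_⟩
    · exact Fin.strictMono_cons.2 ⟨fun i => hLn i, hn⟩
    · exact Fin.cases hL fun i => (Nat.le_succ_of_le hL).trans (hLn i)
    · exact Fin.cases ⟨q, by simpa using hpq⟩ hne
    · refine Fin.cases (fun j hj => ?_) fun i j hj => ?_
      · have : (p : ℕ) < j := (Finset.mem_Ioc.1 hj).1
        simp only [hp, Nat.succPNat_coe] at this
        omega
      · have h2 : (p : ℕ) < q := hpq
        have h3 := hmE i j hj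
        simp only [hp, Nat.succPNat_coe] at h2
        omega
    · rw [Fin.forall_fin_succ]
      simp only [Fin.forall_fin_succ, Fin.cons_zero, Fin.cons_succ, Fin.succ_lt_succ_iff]
      exact ⟨⟨fun h => absurd h (lt_irrefl _),
        fun i' _ a ha b hb => (Finset.mem_Ioc.1 ha).2.trans_lt (hmE i' b hb)⟩,
        fun i => ⟨fun h => absurd h (Fin.not_lt_zero _), hlt i⟩⟩
    · refine Fin.cases (fun u => ?_) happ
      simp only [Fin.cons_zero]
      have hdec : u - proj (Finset.Ioc p q) u = u.filter (· ≤ p) + u.filter (q < ·) := by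
        ext j
        simp only [Finsupp.sub_apply, proj_apply, Finsupp.add_apply, Finsupp.filter_apply,
          Finset.mem_Ioc]
        rcases le_or_gt j p with hj | hj
        · simp [hj, hj.not_gt, (hj.trans hpq.le).not_gt]
        · rcases le_or_gt j q with hj' | hj' 
          · simp [hj, hj.not_ge, hj', hj'.not_gt]
          · simp [hj.not_ge, hj', hj'.not_ge]
      have e1 := abs_apply_filter_le h0 h1.le (y n₀) p u
      have e2 := ht (u.filter (q < ·)) fun j hj => by
        rw [Finsupp.support_filter] at hj
        have : (q : ℕ) < j := (Finset.mem_filter.1 hj).2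
        omega
      have e3 := norm_filter_le h0 h1.le (q < ·) u
      rw [hdec, map_add]
      refine (abs_add_le _ _).trans ?_
      nlinarith [hG.nonneg u]

/-! ### Estimates for separated sequences and spreading models -/

section SpreadingModel

variable {θ : Set.Ioo (0 : ℝ) 1}

/-- A bounded sequence `x` of functionals with weak* cluster point `y`: the differences `x n - y`,
for suitable indices, are almost supported on admissible sets, where `y` is small. -/
lemma exists_admissible {x : ℕ → TDual θ} {y : TDual θ}
    {U : Filter ℕ} [NeBot U] (hU : U ≤ atTop) (hy : ∀ v, Tendsto (fun n => x n v) U (𝓝 (y v)))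
    {η : ℝ} (hη : 0 < η) (k L m : ℕ) :
    ∃ (n : Fin k → ℕ) (E : Fin k → Finset ℕ+), StrictMono n ∧ (∀ i, L ≤ n i) ∧ Admissible E ∧
      (∀ i, ∀ j ∈ E i, m < (j : ℕ)) ∧
      (∀ i u, |ev (x (n i) - y) (u - proj (E i) u)| ≤ η * tsirelsonNorm θ u) ∧
      ∀ i u, |ev y (proj (E i) u)| ≤ η * tsirelsonNorm θ (proj (E i) u) := by
  obtain ⟨t, ht⟩ := exists_tail_le θ.2.1.le θ.2.2 (ev y) (abs_ev_le y) hη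
  obtain ⟨n, E, hn, hL, hne, hm, hlt, happ⟩ := exists_successive_sets θ.2.1.le θ.2.2
    (fun n => abs_ev_le (x n - y)) hU (fun u => by
      have := (hy ((show C00 θ from u : C00 θ) : T θ)).sub_const
        (y ((show C00 θ from u : C00 θ) : T θ))
      rw [sub_self] at this
      exact this) hη k L (max (max k m) t)
  refine ⟨n, E, hn, hL, ⟨hne, fun i j hj => ?_, hlt⟩, fun i j hj => ?_, happ, fun i u => ?_⟩
  · have := hm i j hj; omega
  · have := hm i j hj; omega
  · refine ht _ fun j hj => ?_
    have := hm i j (mem_of_mem_support_proj hj)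
    omega

/-- Separated sequences in the unit ball of the dual of Tsirelson's space. -/
theorem le_inv_of_isSeparatedSeq {σ : ℝ} {x : ℕ → TDual θ} (hx : ∀ n, ‖x n‖ ≤ 1)
    (hs : IsSeparatedSeq σ x) : σ ≤ (θ : ℝ)⁻¹ := by
  have hθ : (0 : ℝ) < θ := θ.2.1
  obtain ⟨y, hy⟩ := exists_pointwise_limit x hx (hyperfilter ℕ)
  refine le_of_forall_pos_le_add fun ε hε => ?_
  -- Two errors `η` come from outside the sets, and `η θ⁻¹` from the values of `y` on them.
  set η := ε / (2 + (θ : ℝ)⁻¹) with hη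
  have hη0 : 0 < η := by positivity
  obtain ⟨n, E, hn, -, hE, -, happ, hyE⟩ :=
    exists_admissible Nat.hyperfilter_le_atTop hy hη0 2 0 0
  refine (hs (n 0) (n 1) (hn (by simp)).ne).trans ?_
  have hbound : (θ : ℝ)⁻¹ + ε = 2 * η + (1 + η) * (θ : ℝ)⁻¹ := by
    have : η * (2 + (θ : ℝ)⁻¹) = ε := div_mul_cancel₀ _ (by positivity)
    linarith
  rw [hbound]
  refine norm_le_of_abs_ev_le (by positivity) fun u => ?_
  have hN := (good_norm θ).nonneg
  have hi : ∀ i, |ev (x (n i) - y) u| ≤ η * tsirelsonNorm θ u +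
      (1 + η) * tsirelsonNorm θ (proj (E i) u) := by
    intro i
    have e1 : ev (x (n i) - y) u = ev (x (n i) - y) (u - proj (E i) u) +
        (ev (x (n i)) (proj (E i) u) - ev y (proj (E i) u)) := by
      simp only [map_sub, LinearMap.sub_apply]; ring
    have e2 := (abs_ev_le (x (n i)) (proj (E i) u)).trans
      (mul_le_mul_of_nonneg_right (hx (n i)) (hN _))
    rw [e1]
    refine (abs_add_le _ _).trans ?_
    have := abs_sub (ev (x (n i)) (proj (E i) u)) (ev y (proj (E i) u))
    linarith [happ i u, hyE i u]
  have e3 : ev (x (n 0) - x (n 1)) u = ev (x (n 0) - y) u - ev (x (n 1) - y) u := by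
    simp only [map_sub, LinearMap.sub_apply]; ring
  have e4 := admissible_sum_le hθ.le θ.2.2.le hE u
  rw [Fin.sum_univ_two] at e4
  have e5 : tsirelsonNorm θ (proj (E 0) u) + tsirelsonNorm θ (proj (E 1) u) ≤
      (θ : ℝ)⁻¹ * tsirelsonNorm θ u := by rwa [le_inv_mul_iff₀ hθ]
  rw [e3]
  refine (abs_sub _ _).trans ?_
  nlinarith [hi 0, hi 1, mul_le_mul_of_nonneg_left e5 (by positivity : 0 ≤ 1 + η)]

/-- Otherwise a subsequence would converge to `y` in norm. This supplies the lower `ℓ_∞` estimate in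
spreading models. -/
lemma eventually_le_norm_sub {X : Type*} [NormedAddCommGroup X] {x : ℕ → X}
    (hx : ∀ φ : ℕ → ℕ, StrictMono φ → ¬ CauchySeq (x ∘ φ)) (y : X) :
    ∃ δ, 0 < δ ∧ ∀ᶠ n in atTop, δ ≤ ‖x n - y‖ := by
  by_contra! hcon
  have hf : ∀ k : ℕ, ∃ᶠ n in atTop, ‖x n - y‖ < 1 / ((k : ℝ) + 1) := fun k => by
    have := hcon (1 / ((k : ℝ) + 1)) (by positivity)
    simpa only [Filter.not_eventually, not_le] using this
  obtain ⟨φ, hφ, hφx⟩ := extraction_forall_of_frequently hf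
  refine hx φ hφ (Tendsto.cauchySeq (x := y) ?_)
  rw [tendsto_iff_norm_sub_tendsto_zero]
  exact squeeze_zero (fun _ => norm_nonneg _) (fun k => (hφx k).le)
    tendsto_one_div_add_atTop_nhds_zero_nat

/-- A spreading model of the dual of Tsirelson's space carries a norm that is equivalent to
`max ‖a‖_∞ (‖y‖ * |∑ i, a i|)`, where `y` is a weak* cluster point of the generating sequence. -/
theorem exists_equivalent_norm {F : Type*} [NormedAddCommGroup F] [NormedSpace ℝ F]
    [CompleteSpace F] {x : ℕ → TDual θ} {e : ℕ → F} (h : IsSpreadingModel x e) :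
    ∃ (y : TDual θ) (δ β C : ℝ), 0 < δ ∧ (y ≠ 0 → 0 < β) ∧ 0 ≤ C ∧ ∀ (k : ℕ) (a : Fin k → ℝ),
      (∀ i, δ * |a i| ≤ ‖∑ i, a i • e (i : ℕ)‖) ∧ β * |∑ i, a i| ≤ ‖∑ i, a i • e (i : ℕ)‖ ∧
      ∀ A, 0 ≤ A → (∀ i, |a i| ≤ A) →
        ‖∑ i, a i • e (i : ℕ)‖ ≤ ‖y‖ * |∑ i, a i| + C * A := by
  have hθ : (0 : ℝ) < θ := θ.2.1
  have hN := (good_norm θ).nonneg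
  obtain ⟨C₀, hC₀⟩ := h.bounded
  obtain ⟨y, hy⟩ := exists_pointwise_limit x hC₀ (hyperfilter ℕ)
  obtain ⟨δ, hδ, hxy⟩ := eventually_le_norm_sub h.not_cauchy y
  obtain ⟨L₀, hL₀⟩ := eventually_atTop.1 hxy
  have hC₀' : 0 ≤ C₀ := (norm_nonneg _).trans (hC₀ 0)
  have hK : ∀ n, ‖x n - y‖ ≤ C₀ + ‖y‖ := fun n =>
    (norm_sub_le _ _).trans (add_le_add (hC₀ n) le_rfl)
  -- One choice of indices serves both purposes: `f = ∑ aᵢ x (nᵢ)` has almost the norm of the model,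
  -- and the differences almost live on admissible sets.
  have core : ∀ (k : ℕ) (a : Fin k → ℝ) (m : ℕ) (η : ℝ), 0 < η →
      ∃ (n : Fin k → ℕ) (E : Fin k → Finset ℕ+) (f : TDual θ), Admissible E ∧
        (∀ i, ∀ j ∈ E i, m < (j : ℕ)) ∧
        (∀ i u, |ev (x (n i) - y) (u - proj (E i) u)| ≤ η * tsirelsonNorm θ u) ∧
        (∀ i u, |ev y (proj (E i) u)| ≤ η * tsirelsonNorm θ (proj (E i) u)) ∧
        (∀ i, δ ≤ ‖x (n i) - y‖) ∧ |‖f‖ - ‖∑ i, a i • e (i : ℕ)‖| ≤ η ∧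
        ∀ u, ev f u = (∑ i, a i) * ev y u + ∑ i, a i * ev (x (n i) - y) u := by
    intro k a m η hη
    obtain ⟨L₁, hL₁⟩ := h.norm_limit k a η hη
    obtain ⟨n, E, hn, hL, hE, hm, happ, hyE⟩ :=
      exists_admissible Nat.hyperfilter_le_atTop hy hη k (max L₀ L₁) m
    refine ⟨n, E, ∑ i, a i • x (n i), hE, hm, happ, hyE,
      fun i => hL₀ _ ((le_max_left _ _).trans (hL i)),
      hL₁ n hn fun i => (le_max_right _ _).trans (hL i), fun u => ?_⟩
    simp only [map_sum, map_smul, LinearMap.sum_apply, LinearMap.smul_apply, smul_eq_mul, map_sub,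
      LinearMap.sub_apply]
    rw [Finset.sum_mul, ← Finset.sum_add_distrib]
    exact Finset.sum_congr rfl fun i _ => by ring
  have off : ∀ {k : ℕ} {n : Fin k → ℕ} {E : Fin k → Finset ℕ+} {η : ℝ} {i : Fin k} {w : ℕ+ →₀ ℝ},
      (∀ i u, |ev (x (n i) - y) (u - proj (E i) u)| ≤ η * tsirelsonNorm θ u) →
      proj (E i) w = 0 → |ev (x (n i) - y) w| ≤ η * tsirelsonNorm θ w := by
    intro k n E η i w happ hw
    have := happ i w
    rwa [hw, sub_zero] at this
  -- The halves allow for test vectors that only almost norm a functional. The last constant bounds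
  -- `‖x n - y‖`, times the `θ⁻¹` of admissible sums.
  refine ⟨y, δ / 2, ‖y‖ / 2, (C₀ + ‖y‖) * (θ : ℝ)⁻¹, by positivity,
    fun h0 => by have := norm_pos_iff.2 h0; positivity, by positivity, fun k a => ⟨?_, ?_, ?_⟩⟩
  · intro i
    set S := ∑ l, |a l| with hS
    have hS0 : 0 ≤ S := Finset.sum_nonneg fun _ _ => abs_nonneg _
    refine le_of_forall_pos_le_add fun ε hε => ?_
    -- The errors are `S η` from `y`, `S η` from the other terms, `|a i| η ≤ S η` from cutting `u`
    -- down to `E i`, and `η` from passing to the model.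
    set η := ε / (3 * S + 1) with hη
    have hη0 : 0 < η := by positivity
    have hηε : η * (3 * S + 1) = ε := div_mul_cancel₀ _ (by positivity)
    obtain ⟨n, E, f, hE, -, happ, hyE, hδn, hf, hev⟩ := core k a 0 η hη0
    obtain ⟨u, hu, hlt⟩ := exists_lt_abs_ev (f := x (n i) - y) (c := δ / 2) (by positivity)
      (by linarith [hδn i])
    -- On `w` both `y` and all the other differences are small, so `f w` isolates the coefficient `a
    -- i`.
    set w := proj (E i) u with hw
    have hwu : tsirelsonNorm θ w ≤ tsirelsonNorm θ u := norm_proj_le hθ.le θ.2.2.le _ _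
    have hwη := mul_le_mul_of_nonneg_left hwu hη0.le
    have e1 : (δ / 2 - η) * tsirelsonNorm θ u ≤ |ev (x (n i) - y) w| := by
      have h2 : ev (x (n i) - y) u = ev (x (n i) - y) (u - w) + ev (x (n i) - y) w := by
        rw [← map_add, sub_add_cancel]
      have h3 := abs_add_le (ev (x (n i) - y) (u - w)) (ev (x (n i) - y) w)
      rw [← h2] at h3
      linarith [happ i u]
    have e2 : ∀ l ∈ Finset.univ.erase i,
        |a l * ev (x (n l) - y) w| ≤ |a l| * (η * tsirelsonNorm θ u) := by
      intro l hl
      rw [abs_mul]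
      refine mul_le_mul_of_nonneg_left ((off happ ?_).trans hwη) (abs_nonneg _)
      refine proj_eq_zero fun j hj => ?_
      rw [hw, proj_apply, if_neg]
      intro hj'
      rcases lt_or_gt_of_ne (Finset.ne_of_mem_erase hl) with hll | hll
      · exact lt_irrefl _ (hE.lt _ _ hll _ hj _ hj')
      · exact lt_irrefl _ (hE.lt _ _ hll _ hj' _ hj)
    have e3 : |∑ l ∈ Finset.univ.erase i, a l * ev (x (n l) - y) w| ≤
        S * (η * tsirelsonNorm θ u) := by
      refine (Finset.abs_sum_le_sum_abs _ _).trans ((Finset.sum_le_sum e2).trans ?_)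
      rw [← Finset.sum_mul]
      refine mul_le_mul_of_nonneg_right ?_ (by positivity)
      exact Finset.sum_le_sum_of_subset_of_nonneg (Finset.erase_subset _ _)
        fun _ _ _ => abs_nonneg _
    have e4 : |(∑ l, a l) * ev y w| ≤ S * (η * tsirelsonNorm θ u) := by
      rw [abs_mul]
      exact mul_le_mul (Finset.abs_sum_le_sum_abs _ _) ((hyE i u).trans hwη) (abs_nonneg _) hS0
    have e5 : a i * ev (x (n i) - y) w = ev f w - (∑ l, a l) * ev y w -
        ∑ l ∈ Finset.univ.erase i, a l * ev (x (n l) - y) w := by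
      rw [hev w, ← Finset.add_sum_erase _ (fun l => a l * ev (x (n l) - y) w) (Finset.mem_univ i)]
      ring
    have e6 : |a i| * |ev (x (n i) - y) w| ≤
        ‖f‖ * tsirelsonNorm θ u + 2 * (S * (η * tsirelsonNorm θ u)) := by
      rw [← abs_mul, e5]
      have h1 := abs_sub (ev f w - (∑ l, a l) * ev y w)
        (∑ l ∈ Finset.univ.erase i, a l * ev (x (n l) - y) w)
      have h2 := abs_sub (ev f w) ((∑ l, a l) * ev y w)
      have h3 := (abs_ev_le f w).trans (mul_le_mul_of_nonneg_left hwu (norm_nonneg f))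
      linarith
    have e7 : |a i| ≤ S := Finset.single_le_sum (f := fun l => |a l|)
      (fun _ _ => abs_nonneg _) (Finset.mem_univ i)
    have e8 : (|a i| * (δ / 2 - η)) * tsirelsonNorm θ u ≤
        (‖f‖ + 2 * S * η) * tsirelsonNorm θ u := by
      have := mul_le_mul_of_nonneg_left e1 (abs_nonneg (a i))
      linarith
    have e9 := le_of_mul_le_mul_right e8 hu
    have e10 := mul_le_mul_of_nonneg_right e7 hη0.le
    have := (abs_le.1 hf).2
    linarith
  · by_cases hy0 : y = 0
    · simp [hy0]
    obtain ⟨v, hv, hlt⟩ := exists_lt_abs_ev (f := y) (c := ‖y‖ / 2) (by positivity)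
      (half_lt_self (norm_pos_iff.2 hy0))
    set S := ∑ l, |a l| with hS
    have hS0 : 0 ≤ S := Finset.sum_nonneg fun _ _ => abs_nonneg _
    refine le_of_forall_pos_le_add fun ε hε => ?_
    set η := ε / (S + 1) with hη
    have hη0 : 0 < η := by positivity
    have hηε : η * (S + 1) = ε := div_mul_cancel₀ _ (by positivity)
    obtain ⟨n, E, f, -, hm, happ, -, -, hf, hev⟩ :=
      -- The sets lie beyond the support of `v`, so the differences are small at `v` and `f v` is
      -- close to `(∑ aᵢ) y v`.
      core k a (v.support.sup fun j => (j : ℕ)) η hη0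
    have e1 : |∑ i, a i * ev (x (n i) - y) v| ≤ S * (η * tsirelsonNorm θ v) := by
      rw [hS, Finset.sum_mul]
      refine (Finset.abs_sum_le_sum_abs _ _).trans (Finset.sum_le_sum fun i _ => ?_)
      rw [abs_mul]
      refine mul_le_mul_of_nonneg_left (off happ (proj_eq_zero fun j hj => ?_)) (abs_nonneg _)
      by_contra hne
      exact absurd (hm i j hj) (not_lt.2 (Finset.le_sup (f := fun j : ℕ+ => (j : ℕ))
        (Finsupp.mem_support_iff.2 hne)))
    have e2 : |∑ i, a i| * |ev y v| ≤
        ‖f‖ * tsirelsonNorm θ v + S * (η * tsirelsonNorm θ v) := by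
      rw [← abs_mul, eq_sub_of_add_eq (hev v).symm]
      have := abs_sub (ev f v) (∑ i, a i * ev (x (n i) - y) v)
      linarith [abs_ev_le f v]
    have e3 : (‖y‖ / 2 * |∑ i, a i|) * tsirelsonNorm θ v ≤ (‖f‖ + S * η) * tsirelsonNorm θ v := by
      have := mul_le_mul_of_nonneg_left hlt.le (abs_nonneg (∑ i, a i))
      linarith
    have e4 := le_of_mul_le_mul_right e3 hv
    have := (abs_le.1 hf).2
    linarith
  · intro A hA haA
    refine le_of_forall_pos_le_add fun ε hε => ?_
    set η := ε / (A * k + 1) with hη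
    have hη0 : 0 < η := by positivity
    have hηε : η * (A * k + 1) = ε := div_mul_cancel₀ _ (by positivity)
    obtain ⟨n, E, f, hE, -, happ, -, -, hf, hev⟩ := core k a 0 η hη0
    have hfn : ‖f‖ ≤ ‖y‖ * |∑ i, a i| + A * (k * η + (C₀ + ‖y‖) * (θ : ℝ)⁻¹) := by
      refine norm_le_of_abs_ev_le (by positivity) fun u => ?_
      have hi : ∀ i, |ev (x (n i) - y) u| ≤ η * tsirelsonNorm θ u +
          (C₀ + ‖y‖) * tsirelsonNorm θ (proj (E i) u) := by
        intro i
        have h2 : ev (x (n i) - y) u =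
            ev (x (n i) - y) (u - proj (E i) u) + ev (x (n i) - y) (proj (E i) u) := by
          rw [← map_add, sub_add_cancel]
        rw [h2]
        exact (abs_add_le _ _).trans (add_le_add (happ i u)
          ((abs_ev_le _ _).trans (mul_le_mul_of_nonneg_right (hK _) (hN _))))
      have e1 : |∑ i, a i * ev (x (n i) - y) u| ≤ A * (k * (η * tsirelsonNorm θ u) +
          (C₀ + ‖y‖) * ∑ i, tsirelsonNorm θ (proj (E i) u)) := by
        calc |∑ i, a i * ev (x (n i) - y) u|
            ≤ ∑ i, |a i * ev (x (n i) - y) u| := Finset.abs_sum_le_sum_abs _ _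
          _ ≤ ∑ i, A * (η * tsirelsonNorm θ u +
              (C₀ + ‖y‖) * tsirelsonNorm θ (proj (E i) u)) := by
              refine Finset.sum_le_sum fun i _ => ?_
              rw [abs_mul]
              exact mul_le_mul (haA i) (hi i) (abs_nonneg _) hA
          _ = _ := by
              rw [← Finset.mul_sum, Finset.sum_add_distrib, ← Finset.mul_sum _ _ (C₀ + ‖y‖),
                Finset.sum_const, Finset.card_univ, Fintype.card_fin, nsmul_eq_mul]
      have e2 : ∑ i, tsirelsonNorm θ (proj (E i) u) ≤ (θ : ℝ)⁻¹ * tsirelsonNorm θ u := by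
        rw [le_inv_mul_iff₀ hθ]
        exact admissible_sum_le hθ.le θ.2.2.le hE u
      have e3 := mul_le_mul_of_nonneg_left e2 (by positivity : 0 ≤ A * (C₀ + ‖y‖))
      have e4 : |(∑ i, a i) * ev y u| ≤ |∑ i, a i| * (‖y‖ * tsirelsonNorm θ u) := by
        rw [abs_mul]
        exact mul_le_mul_of_nonneg_left (abs_ev_le y u) (abs_nonneg _)
      rw [hev u]
      refine (abs_add_le _ _).trans ?_
      linarith
    have := (abs_le.1 hf).1
    linarith

end SpreadingModel

end Tsirelson

open Filter Topology

/-! ### Isomorphisms from equivalent sequences -/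

lemma linearCombination_eq_sum_fin {F : Type*} [AddCommGroup F] [Module ℝ F] (e : ℕ → F)
    (l : ℕ →₀ ℝ) : Finsupp.linearCombination ℝ e l =
      ∑ i : Fin (l.support.sup id + 1), l i • e (i : ℕ) := by
  rw [Finsupp.linearCombination_apply, Fin.sum_univ_eq_sum_range (fun i => l i • e i)]
  refine Finsupp.sum_of_support_subset _ (fun i hi => ?_) _ (by simp)
  exact Finset.mem_range.2 (Nat.lt_succ_of_le (Finset.le_sup (f := id) hi))

lemma denseRange_linearCombination {F : Type*} [NormedAddCommGroup F] [NormedSpace ℝ F]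
    {e : ℕ → F} (he : (Submodule.span ℝ (Set.range e)).topologicalClosure = ⊤) :
    DenseRange (Finsupp.linearCombination ℝ e) := by
  rw [DenseRange, ← LinearMap.coe_range, Finsupp.range_linearCombination]
  exact Submodule.dense_iff_topologicalClosure_eq_top.2 he

/-- Two Banach spaces with equivalent fundamental sequences are isomorphic. -/
theorem nonempty_equiv_of_equivalent {F G : Type*} [NormedAddCommGroup F] [NormedSpace ℝ F]
    [CompleteSpace F] [NormedAddCommGroup G] [NormedSpace ℝ G] [CompleteSpace G]
    {e : ℕ → F} {g : ℕ → G} (he : (Submodule.span ℝ (Set.range e)).topologicalClosure = ⊤)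
    (hg : (Submodule.span ℝ (Set.range g)).topologicalClosure = ⊤) {A B : ℝ}
    (hA : ∀ (k : ℕ) (a : Fin k → ℝ), ‖∑ i, a i • g (i : ℕ)‖ ≤ A * ‖∑ i, a i • e (i : ℕ)‖)
    (hB : ∀ (k : ℕ) (a : Fin k → ℝ), ‖∑ i, a i • e (i : ℕ)‖ ≤ B * ‖∑ i, a i • g (i : ℕ)‖) :
    Nonempty (F ≃L[ℝ] G) := by
  refine ⟨(LinearEquiv.refl ℝ (ℕ →₀ ℝ)).extend (Finsupp.linearCombination ℝ e)
    (Finsupp.linearCombination ℝ g) (denseRange_linearCombination he) ⟨A, fun l => ?_⟩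
    (denseRange_linearCombination hg) ⟨B, fun l => ?_⟩⟩
  · simp only [LinearEquiv.refl_apply, linearCombination_eq_sum_fin]
    exact hA _ _
  · simp only [LinearEquiv.refl_symm, LinearEquiv.refl_apply, linearCombination_eq_sum_fin]
    exact hB _ _

/-! ### Two fundamental sequences of `c₀` -/

namespace ZeroAtInftyContinuousMap

/-- The unit vectors of `c₀`. -/
def unitVec (i : ℕ) : C₀(ℕ, ℝ) where
  toFun := Pi.single i 1
  continuous_toFun := continuous_of_discreteTopology
  zero_at_infty' := by
    rw [cocompact_eq_cofinite]
    refine tendsto_nhds_of_eventually_eq ?_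
    filter_upwards [(Set.finite_singleton i).compl_mem_cofinite] with j hj
    exact Pi.single_eq_of_ne hj 1

lemma unitVec_apply (i j : ℕ) : unitVec i j = if j = i then 1 else 0 := Pi.single_apply i 1 j

lemma norm_le_iff {f : C₀(ℕ, ℝ)} {c : ℝ} (hc : 0 ≤ c) : ‖f‖ ≤ c ↔ ∀ j, |f j| ≤ c := by
  rw [← norm_toBCF_eq_norm, BoundedContinuousFunction.norm_le hc]
  rfl

lemma abs_apply_le_norm (f : C₀(ℕ, ℝ)) (j : ℕ) : |f j| ≤ ‖f‖ := (norm_le_iff (norm_nonneg f)).1 le_rfl j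

/-- Evaluation as a linear map. -/
def evalₗ (j : ℕ) : C₀(ℕ, ℝ) →ₗ[ℝ] ℝ where
  toFun f := f j
  map_add' _ _ := rfl
  map_smul' _ _ := rfl

lemma sum_apply {ι : Type*} (s : Finset ι) (f : ι → C₀(ℕ, ℝ)) (j : ℕ) :
    (∑ i ∈ s, f i) j = ∑ i ∈ s, f i j := map_sum (evalₗ j) f s

lemma span_unitVec : (Submodule.span ℝ (Set.range unitVec)).topologicalClosure = ⊤ := by
  refine eq_top_iff.2 fun f _ => ?_
  refine Metric.mem_closure_iff.2 fun ε hε => ?_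
  have hfin : {j | ε / 2 ≤ |f j|}.Finite := by
    have := f.zero_at_infty'
    rw [cocompact_eq_cofinite] at this
    have h2 := (tendsto_zero_iff_norm_tendsto_zero.1 this).eventually_lt_const (half_pos hε)
    refine (Filter.eventually_cofinite.1 h2).subset fun j hj => not_lt.2 hj
  refine ⟨∑ j ∈ hfin.toFinset, f j • unitVec j, Submodule.sum_mem _ fun j _ =>
    Submodule.smul_mem _ _ (Submodule.subset_span ⟨j, rfl⟩), ?_⟩
  rw [dist_eq_norm]
  refine lt_of_le_of_lt ((norm_le_iff (half_pos hε).le).2 fun j => ?_) (half_lt_self hε)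
  rw [sub_apply, sum_apply]
  simp only [smul_apply, unitVec_apply, smul_eq_mul, mul_ite, mul_one, mul_zero,
    Finset.sum_ite_eq]
  split_ifs with hj
  · simpa using (half_pos hε).le
  · rw [sub_zero]
    exact (not_le.1 fun h => hj (hfin.mem_toFinset.2 h)).le

lemma sum_unitVec_apply {k : ℕ} (a : Fin k → ℝ) (j : ℕ) :
    (∑ i, a i • unitVec i) j = if h : j < k then a ⟨j, h⟩ else 0 := by
  rw [sum_apply]
  simp only [smul_apply, unitVec_apply, smul_eq_mul, mul_ite, mul_one, mul_zero]
  split_ifs with h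
  · rw [Finset.sum_eq_single ⟨j, h⟩]
    · simp
    · intro i _ hi
      exact if_neg fun h' => hi (Fin.ext h'.symm)
    · simp
  · exact Finset.sum_eq_zero fun i _ => if_neg fun h' => h (by rw [h']; exact i.2)

lemma sum_add_unitVec_zero {k : ℕ} (a : Fin k → ℝ) :
    (∑ i : Fin k, a i • (unitVec 0 + unitVec (i + 1))) 0 = ∑ i, a i := by
  rw [sum_apply]
  refine Finset.sum_congr rfl fun i _ => ?_
  simp [unitVec_apply]

lemma sum_add_unitVec_succ {k : ℕ} (a : Fin k → ℝ) (j : ℕ) :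
    (∑ i : Fin k, a i • (unitVec 0 + unitVec (i + 1))) (j + 1) =
      if h : j < k then a ⟨j, h⟩ else 0 := by
  rw [← sum_unitVec_apply a j, sum_apply, sum_apply]
  refine Finset.sum_congr rfl fun i _ => ?_
  simp [unitVec_apply]

/-- The averages of the vectors `e₀ + eᵢ₊₁` tend to `e₀` in norm, so the closed span contains `e₀`
and then every `eᵢ₊₁`. -/
lemma span_add_unitVec :
    (Submodule.span ℝ (Set.range fun i => unitVec 0 + unitVec (i + 1))).topologicalClosure = ⊤ := by
  set V := Submodule.span ℝ (Set.range fun i => unitVec 0 + unitVec (i + 1)) with hV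
  have hmem : ∀ i, unitVec 0 + unitVec (i + 1) ∈ V.topologicalClosure := fun i =>
    V.le_topologicalClosure (Submodule.subset_span ⟨i, rfl⟩)
  have h0 : unitVec 0 ∈ V.topologicalClosure := by
    refine Metric.mem_closure_iff.2 fun ε hε => ?_
    obtain ⟨k, hk⟩ := exists_nat_one_div_lt hε
    refine ⟨∑ i : Fin (k + 1), (1 / ((k : ℝ) + 1)) • (unitVec 0 + unitVec (i + 1)),
      Submodule.sum_mem _ fun i _ => Submodule.smul_mem _ _ (Submodule.subset_span ⟨i, rfl⟩), ?_⟩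
    rw [dist_eq_norm]
    have hk0 : (0 : ℝ) ≤ 1 / ((k : ℝ) + 1) := by positivity
    refine lt_of_le_of_lt ((norm_le_iff hk0).2 fun j => ?_) hk
    rw [sub_apply]
    cases j with
    | zero =>
      rw [sum_add_unitVec_zero]
      have : ((k : ℝ) + 1) * ((k : ℝ) + 1)⁻¹ = 1 := mul_inv_cancel₀ (by positivity)
      simpa [unitVec_apply, this] using hk0
    | succ j =>
      rw [sum_add_unitVec_succ]
      split_ifs
      · simp only [unitVec_apply, Nat.succ_ne_zero, if_false, zero_sub, abs_neg]
        rw [abs_of_nonneg hk0]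
      · simpa [unitVec_apply] using hk0
  have hle : Submodule.span ℝ (Set.range unitVec) ≤ V.topologicalClosure := by
    rw [Submodule.span_le]
    rintro _ ⟨i, rfl⟩
    cases i with
    | zero => exact h0
    | succ i =>
      have := sub_mem (hmem i) h0
      rwa [add_sub_cancel_left] at this
  exact top_le_iff.1 (span_unitVec ▸ Submodule.topologicalClosure_minimal _ hle
    V.isClosed_topologicalClosure)

end ZeroAtInftyContinuousMap

/-! ### Spreading models are isomorphic to `c₀` -/

namespace Tsirelson

open ZeroAtInftyContinuousMap in
/-- Every spreading model of the dual of Tsirelson's space is isomorphic to `c₀`. -/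
theorem nonempty_equiv_of_isSpreadingModel {θ : Set.Ioo (0 : ℝ) 1} {F : Type*}
    [NormedAddCommGroup F] [NormedSpace ℝ F] [CompleteSpace F] {x : ℕ → TDual θ} {e : ℕ → F}
    (h : IsSpreadingModel x e) : Nonempty (F ≃L[ℝ] C₀(ℕ, ℝ)) := by
  obtain ⟨y, δ, β, C, hδ, hβ, hC, hbd⟩ := exists_equivalent_norm h
  by_cases hy : y = 0
  · refine nonempty_equiv_of_equivalent h.dense_span span_unitVec (A := δ⁻¹) (B := C)
      (fun k a => ?_) fun k a => ?_
    · refine (norm_le_iff (by positivity)).2 fun j => ?_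
      rw [sum_unitVec_apply]
      split_ifs with hj
      · rw [le_inv_mul_iff₀ hδ]
        exact (hbd k a).1 _
      · rw [abs_zero]; positivity
    · have := (hbd k a).2.2 ‖∑ i, a i • unitVec i‖ (norm_nonneg _) fun i => by
        have := abs_apply_le_norm (∑ i, a i • unitVec i) i
        rwa [sum_unitVec_apply, dif_pos i.2] at this
      simpa [hy] using this
  · have hβ' := hβ hy
    -- Coordinate `0` of `∑ aᵢ (e₀ + eᵢ₊₁)` records `∑ aᵢ`, the others record the `aᵢ`: exactly the
    -- two quantities in the equivalent norm.
    refine nonempty_equiv_of_equivalent h.dense_span span_add_unitVec (A := δ⁻¹ + β⁻¹)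
      (B := ‖y‖ + C) (fun k a => ?_) fun k a => ?_
    · have hs := (hbd k a).2.1
      have hn := norm_nonneg (∑ i, a i • e (i : ℕ))
      rw [← le_inv_mul_iff₀ hβ'] at hs
      have h1 : 0 ≤ δ⁻¹ * ‖∑ i, a i • e (i : ℕ)‖ := by positivity
      have h2 : 0 ≤ β⁻¹ * ‖∑ i, a i • e (i : ℕ)‖ := by positivity
      refine (norm_le_iff (by positivity)).2 fun j => ?_
      rw [add_mul]
      cases j with
      | zero => rw [sum_add_unitVec_zero]; linarith
      | succ j =>
        rw [sum_add_unitVec_succ]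
        split_ifs with hj
        · have := (hbd k a).1 ⟨j, hj⟩
          rw [← le_inv_mul_iff₀ hδ] at this
          linarith
        · rw [abs_zero]; positivity
    · set f := ∑ i : Fin k, a i • (unitVec 0 + unitVec (i + 1)) with hf
      have hub := (hbd k a).2.2 ‖f‖ (norm_nonneg _) fun i => by
        have := abs_apply_le_norm f (i + 1)
        rwa [hf, sum_add_unitVec_succ, dif_pos i.2] at this
      have h0 := abs_apply_le_norm f 0
      rw [hf, sum_add_unitVec_zero, ← hf] at h0
      have := mul_le_mul_of_nonneg_left h0 (norm_nonneg y)
      linarith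

end Tsirelson

/-! ### A spreading model generated by the coordinate functionals -/

lemma span_topologicalClosure_eq_top {G : Type*} [NormedAddCommGroup G] [NormedSpace ℝ G]
    (e : ℕ → G) {W : Submodule ℝ G} (hW : W = (Submodule.span ℝ (Set.range e)).topologicalClosure)
    (he : ∀ i, e i ∈ W) :
    (Submodule.span ℝ (Set.range fun i => (⟨e i, he i⟩ : W))).topologicalClosure = ⊤ := by
  refine eq_top_iff.2 fun z _ => Metric.mem_closure_iff.2 fun ε hε => ?_
  have hle : Submodule.span ℝ (Set.range e) ≤
      (Submodule.span ℝ (Set.range fun i => (⟨e i, he i⟩ : W))).map W.subtype := by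
    rw [Submodule.span_le]
    rintro _ ⟨i, rfl⟩
    exact ⟨⟨e i, he i⟩, Submodule.subset_span ⟨i, rfl⟩, rfl⟩
  have hz : (z : G) ∈ (Submodule.span ℝ (Set.range e)).topologicalClosure := hW ▸ z.2
  obtain ⟨s, hs, hsz⟩ := Metric.mem_closure_iff.1 hz ε hε
  obtain ⟨s', hs', rfl⟩ := hle hs
  exact ⟨s', hs', hsz⟩

namespace Tsirelson

/-- The sequences `b` with `max ‖b‖_∞ (θ * ‖b‖₁) ≤ 1`. -/
def modelBall (θ : ℝ) : Set (ℕ → ℝ) :=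
  {b | (∀ i, |b i| ≤ 1) ∧ ∀ k, θ * ∑ i ∈ Finset.range k, |b i| ≤ 1}

/-- The coordinate functionals, as bounded functions on `modelBall θ`. -/
def modelVec (θ : ℝ) (i : ℕ) : lp (fun _ : modelBall θ => ℝ) ⊤ :=
  ⟨fun b => b.1 i, memℓp_infty ⟨1, by rintro _ ⟨b, rfl⟩; exact b.2.1 i⟩⟩

lemma sum_modelVec_apply {θ : ℝ} {k : ℕ} (a : Fin k → ℝ) (b : modelBall θ) :
    (∑ i, a i • modelVec θ i : lp (fun _ : modelBall θ => ℝ) ⊤) b = ∑ i, a i * b.1 i := by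
  rw [lp.coeFn_sum, Finset.sum_apply]
  rfl

lemma norm_single_le {θ : Set.Ioo (0 : ℝ) 1} (j : ℕ+) :
    tsirelsonNorm θ (Finsupp.single j 1) ≤ 1 :=
  ((good_norm θ).le_sum _).trans (by simp [Finsupp.sum_single_index])

lemma sum_single_apply {k : ℕ} {n : Fin k → ℕ} (hn : StrictMono n) (b : Fin k → ℝ) (i : Fin k) :
    (∑ l, Finsupp.single (n l).succPNat (b l)) (n i).succPNat = b i := by
  rw [Finsupp.finsetSum_apply, Finset.sum_eq_single i]
  · simp
  · intro l _ hl
    exact Finsupp.single_eq_of_ne fun h => hl (hn.injective (Nat.succPNat_injective h).symm)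
  · simp

/-- Every admissible sum is at most the `ℓ₁` norm, which `modelBall` bounds by `θ⁻¹`. No lower bound
on the `n i` is needed here. -/
lemma norm_sum_single_le {θ : Set.Ioo (0 : ℝ) 1} {k : ℕ} {n : Fin k → ℕ} (hn : StrictMono n)
    {b : ℕ → ℝ} (hb : b ∈ modelBall θ) :
    tsirelsonNorm θ (∑ i : Fin k, Finsupp.single (n i).succPNat (b i)) ≤ 1 := by
  have hθ : (0 : ℝ) ≤ θ := θ.2.1.le
  set u := ∑ i : Fin k, Finsupp.single (n i).succPNat (b i) with hu
  refine norm_le hθ θ.2.2.le (fun j => ?_) fun m E hE => ?_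
  · by_cases hj : ∃ i, (n i).succPNat = j
    · obtain ⟨i, rfl⟩ := hj
      rw [hu, sum_single_apply hn]
      exact hb.1 i
    · push Not at hj
      rw [hu, Finsupp.finsetSum_apply, Finset.sum_eq_zero fun i _ =>
        Finsupp.single_eq_of_ne (hj i).symm]
      simp
  · refine le_trans (mul_le_mul_of_nonneg_left ?_ hθ) (hb.2 k)
    refine ((good_norm θ).le_of_mem ⟨m, E, hE, rfl⟩).trans ?_
    have hsub : u.support ⊆ Finset.univ.image fun i : Fin k => (n i).succPNat := by
      intro j hj
      obtain ⟨i, -, hi⟩ := Finsupp.mem_support_finsetSum j hj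
      have := Finsupp.support_single_subset hi
      simp only [Finset.mem_singleton] at this
      simp [this]
    rw [Finsupp.sum_of_support_subset _ hsub _ (by simp), Finset.sum_image
      (fun i _ l _ h => hn.injective (Nat.succPNat_injective h)),
      ← Fin.sum_univ_eq_sum_range (fun i => |b i|)]
    refine le_of_eq (Finset.sum_congr rfl fun i _ => ?_)
    rw [hu, sum_single_apply hn, mul_one]

/-- The coordinates at `k ≤ n₁ < ⋯ < nₖ` of vectors in the unit ball of `c₀₀` are exactly the first
`k` terms of sequences in `modelBall`: the singletons are admissible, and conversely
`norm_sum_single_le` applies. -/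
lemma norm_sum_basis_eq {θ : Set.Ioo (0 : ℝ) 1} {x : ℕ → TDual θ}
    (hx : ∀ n, ev (x n) = Finsupp.lapply n.succPNat) {k : ℕ} (a : Fin k → ℝ) {n : Fin k → ℕ}
    (hn : StrictMono n) (hk : ∀ i, k ≤ n i) :
    ‖∑ i, a i • x (n i)‖ = ‖∑ i : Fin k, a i • modelVec θ i‖ := by
  have hθ : (0 : ℝ) < θ := θ.2.1
  have hev : ∀ u, ev (∑ i, a i • x (n i)) u = ∑ i, a i * u (n i).succPNat := fun u => by
    simp [map_sum, map_smul, LinearMap.sum_apply, hx]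
  apply le_antisymm
  · refine norm_le_of_abs_ev_le (norm_nonneg _) fun u => ?_
    by_cases hu : u = 0
    · simp [hu, norm_zero' hθ.le θ.2.2.le]
    have hN := norm_pos hθ.le θ.2.2.le hu
    set N := tsirelsonNorm θ u with hNdef
    -- The normalized coordinates of `u`, padded with zeros to a full sequence.
    let c : ℕ → ℝ := fun i => if h : i < k then N⁻¹ * u (n ⟨i, h⟩).succPNat else 0
    have hc : ∀ i : Fin k, c i = N⁻¹ * u (n i).succPNat := fun i => dif_pos i.2
    have hc0 : ∀ i, ¬ i < k → c i = 0 := fun i h => dif_neg h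
    have hproj : ∀ i : Fin k, |u (n i).succPNat| ≤ tsirelsonNorm θ (proj {(n i).succPNat} u) :=
      fun i => by
        refine le_trans (le_of_eq ?_) (abs_le_norm hθ.le θ.2.2.le _ (n i).succPNat)
        rw [proj_apply, if_pos (Finset.mem_singleton_self _)]
    have hadm : Admissible fun i : Fin k => ({(n i).succPNat} : Finset ℕ+) := by
      refine ⟨fun i => Finset.singleton_nonempty _, fun i m hm => ?_, fun i j hij p hp q hq => ?_⟩
      · rw [Finset.mem_singleton.1 hm]
        exact (hk i).trans (Nat.le_succ _)
      · rw [Finset.mem_singleton.1 hp, Finset.mem_singleton.1 hq]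
        exact Nat.succPNat_lt_succPNat.2 (hn hij)
    have hsum : θ * ∑ i : Fin k, |c i| ≤ 1 := by
      have h1 : ∑ i : Fin k, |c i| = N⁻¹ * ∑ i, |u (n i).succPNat| := by
        rw [Finset.mul_sum]
        exact Finset.sum_congr rfl fun i _ => by rw [hc, abs_mul, abs_of_pos (inv_pos.2 hN)]
      rw [h1, mul_left_comm, inv_mul_le_iff₀ hN, mul_one]
      exact (mul_le_mul_of_nonneg_left (Finset.sum_le_sum fun i _ => hproj i) hθ.le).trans
        (admissible_sum_le hθ.le θ.2.2.le hadm u)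
    have hmem : c ∈ modelBall θ := by
      refine ⟨fun i => ?_, fun m => ?_⟩
      · by_cases h : i < k
        · rw [hc ⟨i, h⟩, abs_mul, abs_of_pos (inv_pos.2 hN), inv_mul_le_iff₀ hN, mul_one]
          exact abs_le_norm hθ.le θ.2.2.le u _
        · rw [hc0 i h]; simp
      · refine le_trans (mul_le_mul_of_nonneg_left ?_ hθ.le) hsum
        rw [Fin.sum_univ_eq_sum_range (fun i => |c i|)]
        rw [Finset.sum_subset (Finset.range_mono (le_max_right m k)) fun i _ hi => by
          rw [hc0 i (by simpa using hi), abs_zero]]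
        exact Finset.sum_le_sum_of_subset_of_nonneg (Finset.range_mono (le_max_left m k))
          fun _ _ _ => abs_nonneg _
    have happ := lp.norm_apply_le_norm ENNReal.top_ne_zero
      (∑ i : Fin k, a i • modelVec θ i) ⟨c, hmem⟩
    rw [sum_modelVec_apply, Real.norm_eq_abs] at happ
    have h2 : ∑ i : Fin k, a i * c i = N⁻¹ * ∑ i, a i * u (n i).succPNat := by
      rw [Finset.mul_sum]
      exact Finset.sum_congr rfl fun i _ => by rw [hc]; ring
    rw [h2, abs_mul, abs_of_pos (inv_pos.2 hN), inv_mul_le_iff₀ hN] at happ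
    rw [hev, mul_comm]
    exact happ
  · refine lp.norm_le_of_forall_le (norm_nonneg _) fun b => ?_
    rw [sum_modelVec_apply, Real.norm_eq_abs]
    have h1 := abs_ev_le (∑ i, a i • x (n i)) (∑ i : Fin k, Finsupp.single (n i).succPNat (b.1 i))
    rw [hev] at h1
    simp only [sum_single_apply hn] at h1
    exact h1.trans (mul_le_of_le_one_right (norm_nonneg _) (norm_sum_single_le hn b.2))

/-- The unit vector basis of the dual of Tsirelson's space generates a spreading model. -/
theorem exists_isSpreadingModel (θ : Set.Ioo (0 : ℝ) 1) :
    ∃ (F : Type) (_ : NormedAddCommGroup F) (_ : NormedSpace ℝ F) (_ : CompleteSpace F)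
      (x : ℕ → TDual θ) (e : ℕ → F), IsSpreadingModel x e := by
  have hθ : (0 : ℝ) < θ := θ.2.1
  have hex : ∀ n : ℕ, ∃ f : TDual θ, ev f = Finsupp.lapply n.succPNat := fun n =>
    exists_ev_eq (C := 1) _ fun u => by
      rw [one_mul]
      exact abs_le_norm hθ.le θ.2.2.le u _
  choose x hx using hex
  let W := (Submodule.span ℝ (Set.range (modelVec θ))).topologicalClosure
  have hW : ∀ i, modelVec θ i ∈ W := fun i =>
    Submodule.le_topologicalClosure _ (Submodule.subset_span ⟨i, rfl⟩)
  refine ⟨W, inferInstance, inferInstance,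
    (Submodule.isClosed_topologicalClosure _).completeSpace_coe, x,
    fun i => ⟨modelVec θ i, hW i⟩, ?_⟩
  -- The threshold in the limit is `k` itself, for every `δ`, because the norms agree from there on.
  -- Distinct coordinate functionals are at distance at least `1`, as a unit vector shows.
  refine @IsSpreadingModel.mk _ _ _ _ _ _ (_) _ _ ⟨1, fun n => ?_⟩ (fun φ hφ hc => ?_)
    (fun k a δ hδ => ⟨k, fun n hn hk => ?_⟩) (span_topologicalClosure_eq_top _ rfl hW)
  · refine norm_le_of_abs_ev_le zero_le_one fun u => ?_
    rw [hx, one_mul]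
    exact abs_le_norm hθ.le θ.2.2.le u _
  · obtain ⟨m, hm⟩ := Metric.cauchySeq_iff.1 hc 1 one_pos
    have h1 := hm m le_rfl (m + 1) (Nat.le_succ m)
    rw [dist_eq_norm] at h1
    have h2 := (abs_ev_le ((x ∘ φ) m - (x ∘ φ) (m + 1)) (Finsupp.single (φ m).succPNat 1)).trans
      (mul_le_of_le_one_right (norm_nonneg _) (norm_single_le _))
    have hne : (φ (m + 1)).succPNat ≠ (φ m).succPNat := fun h =>
      (hφ (Nat.lt_succ_self m)).ne' (Nat.succPNat_injective h)
    simp only [Function.comp_apply, map_sub, LinearMap.sub_apply, hx, Finsupp.lapply_apply,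
      Finsupp.single_eq_same, Finsupp.single_eq_of_ne hne, sub_zero, abs_one] at h2
    exact absurd h1 (not_lt.2 h2)
  · rw [norm_sum_basis_eq hx a hn hk]
    have : ‖∑ i : Fin k, a i • (⟨modelVec θ i, hW i⟩ : W)‖ =
        ‖∑ i : Fin k, a i • modelVec θ i‖ := by
      change ‖W.subtype (∑ i : Fin k, a i • (⟨modelVec θ i, hW i⟩ : W))‖ = _
      rw [map_sum]
      rfl
    rw [this, sub_self, abs_zero]
    exact hδ.le

end Tsirelson

/-! ### Kottman's constants -/

/-- The symmetric Kottman constant is at most Kottman's constant. -/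
lemma symmKottmanConstant_le (X : Type*) [NormedAddCommGroup X] :
    symmKottmanConstant X ≤ kottmanConstant X := by
  refine csSup_le_csSup ⟨2, ?_⟩ ⟨0, le_rfl, 0, by simp, fun _ _ _ => by simp⟩ ?_
  · rintro σ ⟨-, x, hx, hs⟩
    refine (hs 0 1 zero_ne_one).trans ((norm_sub_le _ _).trans ?_)
    linarith [hx 0, hx 1]
  · rintro σ ⟨h0, x, hx, hs⟩
    exact ⟨h0, x, hx, fun i j hij => (hs i j hij).1⟩

theorem theoremB (ε : ℝ) (hε : 0 < ε) :
    ∃ θ : Set.Ioo (0 : ℝ) 1,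
      (∃ (F : Type) (_ : NormedAddCommGroup F) (_ : NormedSpace ℝ F) (_ : CompleteSpace F)
        (x : ℕ → Tsirelson.TDual θ) (e : ℕ → F), IsSpreadingModel x e) ∧
      (∀ (F : Type*) [NormedAddCommGroup F] [NormedSpace ℝ F] [CompleteSpace F]
        (x : ℕ → Tsirelson.TDual θ) (e : ℕ → F), IsSpreadingModel x e →
          Nonempty (F ≃L[ℝ] C₀(ℕ, ℝ))) ∧
      symmKottmanConstant (Tsirelson.TDual θ) ≤ kottmanConstant (Tsirelson.TDual θ) ∧
      kottmanConstant (Tsirelson.TDual θ) ≤ 1 + ε := by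
  -- Then the bound `θ⁻¹` on separation constants is `1 + ε`.
  refine ⟨⟨(1 + ε)⁻¹, by positivity, inv_lt_one_of_one_lt₀ (by linarith)⟩,
    Tsirelson.exists_isSpreadingModel _,
    fun F _ _ _ x e h => Tsirelson.nonempty_equiv_of_isSpreadingModel h,
    symmKottmanConstant_le _, ?_⟩
  refine csSup_le ⟨0, le_rfl, 0, by simp, fun _ _ _ => by simp⟩ ?_
  rintro σ ⟨-, x, hx, hs⟩
  simpa using Tsirelson.le_inv_of_isSeparatedSeq hx hs

end
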